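/- Let $\kappa$ be a field and let $\Gamma<\mathbb{R}$ be a discrete additive subgroup. Let $\Lambda=\kappa[\Gamma]$ be the group algebra, whose elements are the finite sums $\sum_{g\in\Gamma}a_gT^g$ with $a_g\in\kappa$. Let $\Lambda_\uparrow$ (resp. $\Lambda^\downarrow$) be the field of formal sums $\sum_{g\in\Gamma}a_gT^g$ with $a_g\in\kappa$ such that for every $C\in\mathbb{R}$ only finitely many $g<C$ (resp. $g>-C$) have $a_g\neq 0$. Both fields contain $\Lambda$. Put $\nu_\uparrow(\sum a_gT^g)=\min\{g\mid a_g\ne0\}$ on $\Lambda_\uparrow$ and $\nu^\downarrow(\sum a_gT^g)=\max\{g\mid a_g\neq0\}$ on $\Lambda^\downarrow$, with $\nu_\uparrow(0)=\infty$ and $\nu^\downarrow(0)=-\infty$. A normed $\Lambda_\uparrow$-space is a finite-dimensional $\Lambda_\uparrow$-vector space $V_\uparrow$ with a function $\rho_\uparrow\colon V_\uparrow\to\mathbb{R}\cup\{-\infty\}$ such that $\rho_\uparrow(x)=-\infty$ iff $x=0$, $\rho_\uparrow(\lambda x)=\rho_\uparrow(x)-\nu_\uparrow(\lambda)$ and $\rho_\uparrow(x+y)\le\max\{\rho_\uparrow(x),\rho_\uparrow(y)\}$.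 A basis $b_1,\dots,b_d$ of $V_\uparrow$ is $\rho_\uparrow$-orthogonal if $\rho_\uparrow(\sum_i\lambda_ib_i)=\max_i(\rho_\uparrow(b_i)-\nu_\uparrow(\lambda_i))$ for all $\lambda_1,\dots,\lambda_d\in\Lambda_\uparrow$. Dually, a normed $\Lambda^\downarrow$-space is a finite-dimensional $\Lambda^\downarrow$-vector space $V^\downarrow$ with a function $\rho^\downarrow\colon V^\downarrow\to\mathbb{R}\cup\{\infty\}$ such that $\rho^\downarrow(x)=\infty$ iff $x=0$, $\rho^\downarrow(\lambda x)=\rho^\downarrow(x)-\nu^\downarrow(\lambda)$ and $\rho^\downarrow(x+y)\ge\min\{\rho^\downarrow(x),\rho^\downarrow(y)\}$. A basis $b_1,\dots,b_d$ of $V^\downarrow$ is $\rho^\downarrow$-orthogonal if $\rho^\downarrow(\sum_i\lambda_ib_i)=\min_i(\rho^\downarrow(b_i)-\nu^\downarrow(\lambda_i))$ for all $\lambda_1,\dots,\lambda_d\in\Lambda^\downarrow$. A filtered matched pair consists of a finitely generated $\Lambda$-module $H$, a normed $\Lambda_\uparrow$-space $(V_\uparrow,\rho_\uparrow)$, a normed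 $\Lambda^\downarrow$-space $(V^\downarrow,\rho^\downarrow)$, and $\Lambda$-module homomorphisms $\phi_\uparrow\colon H\to V_\uparrow$ and $\phi^\downarrow\colon H\to V^\downarrow$ such that the induced maps $\Lambda_\uparrow\otimes_\Lambda H\to V_\uparrow$ and $\Lambda^\downarrow\otimes_\Lambda H\to V^\downarrow$ are isomorphisms. **Theorem.** If $\Gamma$ is discrete, every filtered matched pair has a doubly-orthogonal basis, that is, there are $d\ge 0$ and $e_1,\dots,e_d\in H$ such that (i) the classes of $e_1,\dots,e_d$ form a basis of the $\Lambda$-module $H/tH$, where $tH$ is the $\Lambda$-torsion submodule of $H$; (ii) $\phi_\uparrow(e_1),\dots,\phi_\uparrow(e_d)$ is a $\rho_\uparrow$-orthogonal basis of $V_\uparrow$; and (iii) $\phi^\downarrow(e_1),\dots,\phi^\downarrow(e_d)$ is a $\rho^\downarrow$-orthogonal basis of $V^\downarrow$. -/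

import Mathlib

/-! ### Novikov fields

Throughout, `κ` is a field and `Γ` is an additive subgroup of `ℝ`. The group algebra `Λ = κ[Γ]` is
`AddMonoidAlgebra κ Γ`. -/

/-- For a strictly increasing additive map `v : G → ℝ`, the subring of the ring of Hahn series
over `G` consisting of those `∑ a_g T^g` such that, for every real `C`, only finitely many `g` with
`v g < C` have `a_g ≠ 0`. It is used below with `G = Γ` (and `v g = g`) and with `G = Γ` equipped
with the reversed order (and `v g = -g`). -/
noncomputable def novikovSubring (κ : Type*) [Field κ] {G : Type*} [AddCommGroup G] [LinearOrder G]
    [IsOrderedAddMonoid G] (v : G →+ ℝ) (hv : StrictMono v) : Subring (HahnSeries G κ) where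
  carrier := {x | ∀ C : ℝ, {g : G | x.coeff g ≠ 0 ∧ v g < C}.Finite}
  zero_mem' := fun C => by simp
  one_mem' := fun C => by
    refine (Set.finite_singleton (0 : G)).subset ?_
    rintro g ⟨hg, -⟩
    by_contra h
    exact hg (by rw [HahnSeries.coeff_one, if_neg (by simpa using h)])
  add_mem' := fun {x y} hx hy C => by
    refine ((hx C).union (hy C)).subset ?_
    rintro g ⟨hg, hC⟩
    by_contra h
    simp only [Set.mem_union, Set.mem_ofPred_eq, not_or, not_and] at h
    have h1 : x.coeff g = 0 := by by_contra h'; exact h.1 h' hC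
    have h2 : y.coeff g = 0 := by by_contra h'; exact h.2 h' hC
    exact hg (by rw [HahnSeries.coeff_add, h1, h2, add_zero])
  neg_mem' := fun {x} hx C => by simpa using hx C
  mul_mem' := fun {x y} hx hy C => by
    refine ((hx (C - v y.order)).add (hy (C - v x.order))).subset ?_
    rintro g ⟨hg, hC⟩
    obtain ⟨i, hi, j, hj, rfl⟩ := Set.mem_add.1 (HahnSeries.support_mul_subset
      ((HahnSeries.mem_support _ _).2 hg))
    rw [map_add] at hC
    have h1 := hv.monotone (HahnSeries.order_le_of_coeff_ne_zero hi)
    have h2 := hv.monotone (HahnSeries.order_le_of_coeff_ne_zero hj)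
    exact Set.add_mem_add ⟨hi, by linarith⟩ ⟨hj, by linarith⟩

theorem inv_mem_novikovSubring {κ : Type*} [Field κ] {G : Type*} [AddCommGroup G] [LinearOrder G]
    [IsOrderedAddMonoid G] (v : G →+ ℝ) (hv : StrictMono v) (x : HahnSeries G κ)
    (hx : x ∈ novikovSubring κ v hv) : x⁻¹ ∈ novikovSubring κ v hv := by
  by_cases x0 : x = 0
  · rw [x0, inv_zero]
    exact zero_mem _
  have hsingle : ∀ (a : G) (c : κ), HahnSeries.single a c ∈ novikovSubring κ v hv := by
    intro a c C
    refine (Set.finite_singleton a).subset ?_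
    rintro g ⟨hg, -⟩
    by_contra h
    exact hg (HahnSeries.coeff_single_of_ne h)
  have hl : x.leadingCoeff ≠ 0 := HahnSeries.leadingCoeff_ne_zero.mpr x0
  set m : HahnSeries G κ := HahnSeries.single (-x.order) x.leadingCoeff⁻¹ with hm
  have hm0 : m ≠ 0 := by
    rw [hm]
    exact HahnSeries.single_ne_zero (inv_ne_zero hl)
  set r : HahnSeries G κ := 1 - m * x with hr
  have hrS : r ∈ novikovSubring κ v hv :=
    sub_mem (one_mem _) (mul_mem (hsingle _ _) hx)
  have hrpos : 0 < r.orderTop :=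
    HahnSeries.unit_aux x (inv_mul_cancel₀ hl) _ (neg_add_cancel x.order)
  have hy0 : 1 - r ≠ 0 := by
    rw [hr, sub_sub_cancel]
    exact mul_ne_zero hm0 x0
  have hinv : x⁻¹ = m * (1 - r)⁻¹ := by
    rw [hr, sub_sub_cancel, mul_inv, ← mul_assoc, mul_inv_cancel₀ hm0, one_mul]
  rw [hinv]
  refine mul_mem (hsingle _ _) ?_
  by_cases r0 : r = 0
  · rw [r0, sub_zero, inv_one]
    exact one_mem _
  have hz0 : (1 - r)⁻¹ ≠ 0 := inv_ne_zero hy0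
  have hro : 0 < r.order := (HahnSeries.zero_lt_orderTop_iff r0).1 hrpos
  have hvr : 0 < v r.order := by simpa using hv hro
  intro C
  obtain ⟨N, hN⟩ := exists_nat_gt ((C - v (1 - r)⁻¹.order) / v r.order)
  rw [div_lt_iff₀ hvr] at hN
  have hdec : (1 - r)⁻¹ = ∑ i ∈ Finset.range N, r ^ i + r ^ N * (1 - r)⁻¹ := by
    have h := mul_neg_geom_sum r N
    field_simp
    linear_combination -h
  have hsum : ∑ i ∈ Finset.range N, r ^ i ∈ novikovSubring κ v hv :=
    sum_mem fun i _ => pow_mem hrS i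
  refine (hsum C).subset ?_
  rintro g ⟨hg, hC⟩
  refine ⟨?_, hC⟩
  rw [hdec, HahnSeries.coeff_add,
    HahnSeries.coeff_eq_zero_of_lt_order (x := r ^ N * (1 - r)⁻¹), add_zero] at hg
  · exact hg
  · refine hv.lt_iff_lt.1 ?_
    rw [HahnSeries.order_mul (pow_ne_zero N r0) hz0, HahnSeries.order_pow, map_add, map_nsmul,
      nsmul_eq_mul]
    linarith

/-- The ring `novikovSubring κ v hv` as a subfield of the field of Hahn series. -/
noncomputable def novikovSubfield (κ : Type*) [Field κ] {G : Type*} [AddCommGroup G] [LinearOrder G]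
    [IsOrderedAddMonoid G] (v : G →+ ℝ) (hv : StrictMono v) : Subfield (HahnSeries G κ) where
  toSubring := novikovSubring κ v hv
  inv_mem' := inv_mem_novikovSubring v hv

/-- The inclusion of the group algebra in the Hahn series, `∑ a_g T^g ↦ ∑ a_g T^(e g)`, as an
additive map. -/
noncomputable def groupAlgebraToHahnAdd (κ : Type*) [Field κ] {Γ : AddSubgroup ℝ} {G : Type*}
    [AddCommGroup G] [LinearOrder G] [IsOrderedAddMonoid G] (e : Γ ≃+ G) :
    AddMonoidAlgebra κ Γ →+ HahnSeries G κ where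
  toFun x := ⟨fun g => x.coeff (e.symm g), by
    refine Set.Finite.isPWO ?_
    refine (x.coeff.support.finite_toSet.image e).subset ?_
    intro g hg
    exact ⟨e.symm g, by simpa using hg, by simp⟩⟩
  map_zero' := by ext g; simp
  map_add' x y := by ext g; simp

theorem groupAlgebraToHahnAdd_single (κ : Type*) [Field κ] {Γ : AddSubgroup ℝ} {G : Type*}
    [AddCommGroup G] [LinearOrder G] [IsOrderedAddMonoid G] (e : Γ ≃+ G) (h : Γ) (a : κ) :
    groupAlgebraToHahnAdd κ e (AddMonoidAlgebra.single h a) = HahnSeries.single (e h) a := by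
  classical
  ext g
  change (AddMonoidAlgebra.single h a).coeff (e.symm g) = _
  rw [AddMonoidAlgebra.coeff_single]
  by_cases hg : g = e h
  · rw [hg, HahnSeries.coeff_single_same, e.symm_apply_apply, Finsupp.single_eq_same]
  · rw [HahnSeries.coeff_single_of_ne hg, Finsupp.single_eq_of_ne]
    rwa [ne_eq, AddEquiv.symm_apply_eq]

/-- The inclusion of the group algebra in the field of Hahn series as a ring homomorphism. -/
noncomputable def groupAlgebraToHahn (κ : Type*) [Field κ] {Γ : AddSubgroup ℝ} {G : Type*}
    [AddCommGroup G] [LinearOrder G] [IsOrderedAddMonoid G] (e : Γ ≃+ G) :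
    AddMonoidAlgebra κ Γ →+* HahnSeries G κ where
  __ := groupAlgebraToHahnAdd κ e
  map_one' := by
    change groupAlgebraToHahnAdd κ e 1 = 1
    rw [AddMonoidAlgebra.one_def, groupAlgebraToHahnAdd_single, map_zero,
      HahnSeries.single_zero_one]
  map_mul' x y := by
    change groupAlgebraToHahnAdd κ e (x * y) =
      groupAlgebraToHahnAdd κ e x * groupAlgebraToHahnAdd κ e y
    induction x using AddMonoidAlgebra.induction_linear with
    | zero => simp
    | add f g hf hg => rw [add_mul, map_add, hf, hg, map_add, add_mul]
    | single m a =>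
      induction y using AddMonoidAlgebra.induction_linear with
      | zero => simp
      | add f g hf hg => rw [mul_add, map_add, hf, hg, map_add, mul_add]
      | single n b =>
        rw [AddMonoidAlgebra.single_mul_single, groupAlgebraToHahnAdd_single,
          groupAlgebraToHahnAdd_single, groupAlgebraToHahnAdd_single,
          HahnSeries.single_mul_single, map_add]

theorem groupAlgebraToHahn_mem (κ : Type*) [Field κ] {Γ : AddSubgroup ℝ} {G : Type*}
    [AddCommGroup G] [LinearOrder G] [IsOrderedAddMonoid G] (v : G →+ ℝ) (hv : StrictMono v)
    (e : Γ ≃+ G) (x : AddMonoidAlgebra κ Γ) :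
    groupAlgebraToHahn κ e x ∈ novikovSubfield κ v hv := by
  intro C
  refine (x.coeff.support.finite_toSet.image e).subset ?_
  rintro g ⟨hg, -⟩
  exact ⟨e.symm g, Finsupp.mem_support_iff.2 hg, by simp⟩

/-- The map `g ↦ -g` from `Γ` with the reversed order to `ℝ`. -/
def dualVal (Γ : AddSubgroup ℝ) : Γᵒᵈ →+ ℝ where
  toFun g := -((OrderDual.ofDual g : Γ) : ℝ)
  map_zero' := by simp
  map_add' g h := by
    rw [ofDual_add, AddSubgroup.coe_add, neg_add]

theorem dualVal_strictMono (Γ : AddSubgroup ℝ) : StrictMono (dualVal Γ) :=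
  fun _ _ h => neg_lt_neg (Subtype.coe_lt_coe.2 (OrderDual.ofDual_lt_ofDual.2 h))

/-- `Γ` is, as a group, the same as `Γ` with the reversed order. -/
def toDualAddEquiv (Γ : AddSubgroup ℝ) : Γ ≃+ Γᵒᵈ where
  __ := OrderDual.toDual
  map_add' _ _ := rfl

/-- The Novikov field `Λ_↑`: formal sums `∑_{g ∈ Γ} a_g T^g` with `a_g ∈ κ` such that for every real
`C` only finitely many `g < C` have `a_g ≠ 0`. -/
def NovikovUp (κ : Type*) [Field κ] (Γ : AddSubgroup ℝ) : Type _ :=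
  novikovSubfield κ Γ.subtype (Subtype.strictMono_coe _)

/-- The Novikov field `Λ^↓`: formal sums `∑_{g ∈ Γ} a_g T^g` with `a_g ∈ κ` such that for every real
`C` only finitely many `g > -C` have `a_g ≠ 0`. -/
def NovikovDown (κ : Type*) [Field κ] (Γ : AddSubgroup ℝ) : Type _ :=
  novikovSubfield κ (dualVal Γ) (dualVal_strictMono Γ)

section

variable (κ : Type*) [Field κ] (Γ : AddSubgroup ℝ)

noncomputable instance instFieldNovikovUp : Field (NovikovUp κ Γ) :=
  inferInstanceAs (Field (novikovSubfield κ Γ.subtype (Subtype.strictMono_coe _)))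

noncomputable instance instFieldNovikovDown : Field (NovikovDown κ Γ) :=
  inferInstanceAs (Field (novikovSubfield κ (dualVal Γ) (dualVal_strictMono Γ)))

/-- The inclusion `Λ ⊆ Λ_↑`. -/
noncomputable def inclUp : AddMonoidAlgebra κ Γ →+* NovikovUp κ Γ :=
  (groupAlgebraToHahn κ (AddEquiv.refl Γ)).codRestrict
    (novikovSubfield κ Γ.subtype (Subtype.strictMono_coe _))
    (groupAlgebraToHahn_mem κ _ _ _)

/-- The inclusion `Λ ⊆ Λ^↓`. -/
noncomputable def inclDown : AddMonoidAlgebra κ Γ →+* NovikovDown κ Γ :=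
  (groupAlgebraToHahn κ (toDualAddEquiv Γ)).codRestrict
    (novikovSubfield κ (dualVal Γ) (dualVal_strictMono Γ))
    (groupAlgebraToHahn_mem κ _ _ _)

noncomputable instance instAlgebraNovikovUp : Algebra (AddMonoidAlgebra κ Γ) (NovikovUp κ Γ) :=
  (inclUp κ Γ).toAlgebra

noncomputable instance instAlgebraNovikovDown : Algebra (AddMonoidAlgebra κ Γ) (NovikovDown κ Γ) :=
  (inclDown κ Γ).toAlgebra

end

section

variable {κ : Type*} [Field κ] {Γ : AddSubgroup ℝ}

/-- The coefficient of `T^g` in an element of `Λ_↑`. -/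
def NovikovUp.coeff (x : NovikovUp κ Γ) (g : Γ) : κ := HahnSeries.coeff x.1 g

/-- The coefficient of `T^g` in an element of `Λ^↓`. -/
def NovikovDown.coeff (x : NovikovDown κ Γ) (g : Γ) : κ :=
  HahnSeries.coeff x.1 (OrderDual.toDual g)

theorem NovikovUp.finite_coeff (x : NovikovUp κ Γ) (C : ℝ) :
    {g : Γ | x.coeff g ≠ 0 ∧ (g : ℝ) < C}.Finite := x.2 C

theorem NovikovDown.finite_coeff (x : NovikovDown κ Γ) (C : ℝ) :
    {g : Γ | x.coeff g ≠ 0 ∧ (g : ℝ) > -C}.Finite :=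
  (x.2 C).subset fun _ hg => ⟨hg.1, neg_lt.1 hg.2⟩

theorem coeff_inclUp (x : AddMonoidAlgebra κ Γ) (g : Γ) :
    (inclUp κ Γ x).coeff g = x.coeff g := rfl

theorem coeff_inclDown (x : AddMonoidAlgebra κ Γ) (g : Γ) :
    (inclDown κ Γ x).coeff g = x.coeff g := rfl

/-- `ν_↑ (∑ a_g T^g) = min {g | a_g ≠ 0}`, with value `∞` at `0`. -/
noncomputable def nuUp (x : NovikovUp κ Γ) : EReal :=
  ⨅ g ∈ {g : Γ | x.coeff g ≠ 0}, ((g : ℝ) : EReal)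

/-- `ν^↓ (∑ a_g T^g) = max {g | a_g ≠ 0}`, with value `-∞` at `0`. -/
noncomputable def nuDown (x : NovikovDown κ Γ) : EReal :=
  ⨆ g ∈ {g : Γ | x.coeff g ≠ 0}, ((g : ℝ) : EReal)

/-! ### Normed spaces over the Novikov fields and orthogonality -/

/-- `ρ : V → ℝ ∪ {-∞}` makes the `Λ_↑`-vector space `V` a normed `Λ_↑`-space (finite-dimensionality
of `V` is required separately). -/
structure IsNormUp {V : Type*} [AddCommGroup V] [Module (NovikovUp κ Γ) V] (ρ : V → EReal) :
    Prop where
  ne_top : ∀ x, ρ x ≠ ⊤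
  eq_bot_iff : ∀ x, ρ x = ⊥ ↔ x = 0
  smul : ∀ (c : NovikovUp κ Γ) (x : V), ρ (c • x) = ρ x - nuUp c
  add_le : ∀ x y, ρ (x + y) ≤ max (ρ x) (ρ y)

/-- `ρ : V → ℝ ∪ {∞}` makes the `Λ^↓`-vector space `V` a normed `Λ^↓`-space (finite-dimensionality
of `V` is required separately). -/
structure IsNormDown {V : Type*} [AddCommGroup V] [Module (NovikovDown κ Γ) V] (ρ : V → EReal) :
    Prop where
  ne_bot : ∀ x, ρ x ≠ ⊥
  eq_top_iff : ∀ x, ρ x = ⊤ ↔ x = 0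
  smul : ∀ (c : NovikovDown κ Γ) (x : V), ρ (c • x) = ρ x - nuDown c
  le_add : ∀ x y, min (ρ x) (ρ y) ≤ ρ (x + y)

end

/-- `b` is a `ρ`-orthogonal basis of the `Λ_↑`-vector space `V`: it is a basis and
`ρ (∑ cᵢ bᵢ) = max (ρ bᵢ - ν_↑ cᵢ)` for all coefficients (an empty maximum being `-∞`). -/
structure IsOrthogonalBasisUp (κ : Type*) [Field κ] (Γ : AddSubgroup ℝ) {V : Type*}
    [AddCommGroup V] [Module (NovikovUp κ Γ) V] (ρ : V → EReal) {d : ℕ} (b : Fin d → V) :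
    Prop where
  linearIndependent : LinearIndependent (NovikovUp κ Γ) b
  span_eq_top : Submodule.span (NovikovUp κ Γ) (Set.range b) = ⊤
  orthogonal : ∀ c : Fin d → NovikovUp κ Γ,
    ρ (∑ i, c i • b i) = Finset.univ.sup fun i => ρ (b i) - nuUp (c i)

/-- `b` is a `ρ`-orthogonal basis of the `Λ^↓`-vector space `V`: it is a basis and
`ρ (∑ cᵢ bᵢ) = min (ρ bᵢ - ν^↓ cᵢ)` for all coefficients (an empty minimum being `∞`). -/
structure IsOrthogonalBasisDown (κ : Type*) [Field κ] (Γ : AddSubgroup ℝ) {V : Type*}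
    [AddCommGroup V] [Module (NovikovDown κ Γ) V] (ρ : V → EReal) {d : ℕ} (b : Fin d → V) :
    Prop where
  linearIndependent : LinearIndependent (NovikovDown κ Γ) b
  span_eq_top : Submodule.span (NovikovDown κ Γ) (Set.range b) = ⊤
  orthogonal : ∀ c : Fin d → NovikovDown κ Γ,
    ρ (∑ i, c i • b i) = Finset.univ.inf fun i => ρ (b i) - nuDown (c i)

/-! ### Filtered matched pairs and doubly-orthogonal bases -/

/-- A filtered matched pair `H → (V_↑, ρ_↑)`, `H → (V^↓, ρ^↓)`. The conditions `isBaseChange_up` and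
`isBaseChange_down` say that the induced maps `Λ_↑ ⊗_Λ H → V_↑` and `Λ^↓ ⊗_Λ H → V^↓` are
isomorphisms. -/
structure FilteredMatchedPair (κ : Type*) [Field κ] (Γ : AddSubgroup ℝ)
    (H : Type*) [AddCommGroup H] [Module (AddMonoidAlgebra κ Γ) H]
    (Vup : Type*) [AddCommGroup Vup] [Module (NovikovUp κ Γ) Vup]
    [Module (AddMonoidAlgebra κ Γ) Vup] [IsScalarTower (AddMonoidAlgebra κ Γ) (NovikovUp κ Γ) Vup]
    (Vdown : Type*) [AddCommGroup Vdown] [Module (NovikovDown κ Γ) Vdown]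
    [Module (AddMonoidAlgebra κ Γ) Vdown]
    [IsScalarTower (AddMonoidAlgebra κ Γ) (NovikovDown κ Γ) Vdown] where
  finite_H : Module.Finite (AddMonoidAlgebra κ Γ) H
  finite_up : Module.Finite (NovikovUp κ Γ) Vup
  finite_down : Module.Finite (NovikovDown κ Γ) Vdown
  rhoUp : Vup → EReal
  isNorm_up : IsNormUp (κ := κ) (Γ := Γ) rhoUp
  rhoDown : Vdown → EReal
  isNorm_down : IsNormDown (κ := κ) (Γ := Γ) rhoDown
  phiUp : H →ₗ[AddMonoidAlgebra κ Γ] Vup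
  isBaseChange_up : IsBaseChange (NovikovUp κ Γ) phiUp
  phiDown : H →ₗ[AddMonoidAlgebra κ Γ] Vdown
  isBaseChange_down : IsBaseChange (NovikovDown κ Γ) phiDown

/-- `e₁, …, e_d ∈ H` is a doubly-orthogonal basis for the filtered matched pair `P`: it projects to
a basis of the `Λ`-module `H / tH`, where `tH` is the torsion submodule, and its images in `V_↑` and
`V^↓` are a `ρ_↑`-orthogonal basis and a `ρ^↓`-orthogonal basis respectively. -/
structure FilteredMatchedPair.IsDoublyOrthogonalBasis {κ : Type*} [Field κ] {Γ : AddSubgroup ℝ}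
    {H : Type*} [AddCommGroup H] [Module (AddMonoidAlgebra κ Γ) H]
    {Vup : Type*} [AddCommGroup Vup] [Module (NovikovUp κ Γ) Vup]
    [Module (AddMonoidAlgebra κ Γ) Vup] [IsScalarTower (AddMonoidAlgebra κ Γ) (NovikovUp κ Γ) Vup]
    {Vdown : Type*} [AddCommGroup Vdown] [Module (NovikovDown κ Γ) Vdown]
    [Module (AddMonoidAlgebra κ Γ) Vdown]
    [IsScalarTower (AddMonoidAlgebra κ Γ) (NovikovDown κ Γ) Vdown]
    (P : FilteredMatchedPair κ Γ H Vup Vdown) {d : ℕ} (e : Fin d → H) : Prop where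
  linearIndependent : LinearIndependent (AddMonoidAlgebra κ Γ)
    fun i => (Submodule.torsion (AddMonoidAlgebra κ Γ) H).mkQ (e i)
  span_eq_top : Submodule.span (AddMonoidAlgebra κ Γ)
    (Set.range fun i => (Submodule.torsion (AddMonoidAlgebra κ Γ) H).mkQ (e i)) = ⊤
  up : IsOrthogonalBasisUp κ Γ P.rhoUp fun i => P.phiUp (e i)
  down : IsOrthogonalBasisDown κ Γ P.rhoDown fun i => P.phiDown (e i)

/-! Exponentiating `ρ_↑` and `-ρ^↓` gives ultrametric norms on `V_↑` and `V^↓`, over Novikov fields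
that are complete for the absolute values `exp(-ν_↑)` and `exp(ν^↓)`. The basis is a system of
successive minima, modulo torsion, for the product D(x) = ‖φ_↑ x‖ · ‖φ^↓ x‖. This function is
unchanged when x is multiplied by a monomial, because the two absolute values of a monomial are
inverse to each other.

Minima exist because D is discrete and bounded below off torsion. Since Γ is discrete and each space
has an orthogonal basis (`exists_isNormOrthogonal_basis`), the values of D off torsion lie in
finitely many scaled copies of exp(Γ). For the lower bound, finitely many functionals H → Λ detect
non-torsion (`exists_functionals_detecting_torsion`). They extend to bounded functionals on both
spaces, and a nonzero a ∈ Λ satisfies |a|_↑ |a|^↓ ≥ 1 (`one_le_norm_mul_norm`).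

The heart is `IsSuccessiveMinima.isNormOrthogonal`. Suppose a combination ∑ c_j φ_↑(e_j) is smaller
than its largest term, of size s. Keep only the indices whose terms have size s and replace their
coefficients by leading monomials m_i; this gives y = ∑ m_i e_i in H with ‖φ_↑ y‖ < s. If k is the
last index kept, then ‖φ^↓ y‖ ≤ D(e_k)/s, so D(y) < D(e_k). But m_k is a unit, so y was a candidate
when e_k was chosen: a contradiction. D is symmetric in the two norms, so the same system is
orthogonal on both sides.

Orthogonality bounds the length of the system by dim `V_↑`, so the choice stops, and it can stop
only when the e_i generate H modulo torsion. -/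

/-! ### Discrete value sets and orthogonal bases of ultrametric spaces -/

/-- A finite family in a normed space is orthogonal if no term of a linear combination is larger than
the linear combination. -/
def IsNormOrthogonal (K : Type*) [NormedField K] {V ι : Type*} [NormedAddCommGroup V]
    [NormedSpace K V] [Fintype ι] (b : ι → V) : Prop :=
  ∀ (c : ι → K) (i : ι), ‖c i‖ * ‖b i‖ ≤ ‖∑ j, c j • b j‖

/-- A set of real numbers has finitely many elements in every compact interval of `(0, ∞)`. -/
def IsDiscretePos (S : Set ℝ) : Prop := ∀ a b : ℝ, 0 < a → (S ∩ Set.Icc a b).Finite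

theorem IsDiscretePos.biUnion_smul {S : Set ℝ} (hS : IsDiscretePos S) {ι : Type*} [Finite ι]
    (r : ι → ℝ) (hr : ∀ i, 0 < r i) : IsDiscretePos {x | ∃ i, ∃ s ∈ S, x = r i * s} := by
  intro a b ha
  have : {x | ∃ i, ∃ s ∈ S, x = r i * s} ∩ Set.Icc a b ⊆
      ⋃ i, (fun s => r i * s) '' (S ∩ Set.Icc (a / r i) (b / r i)) := by
    rintro x ⟨⟨i, s, hs, rfl⟩, h1, h2⟩
    refine Set.mem_iUnion.2 ⟨i, s, ⟨hs, ?_, ?_⟩, rfl⟩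
    · rw [div_le_iff₀ (hr i)]; linarith
    · rw [le_div_iff₀ (hr i)]; linarith
  exact (Set.finite_iUnion fun i => (hS _ _ (div_pos ha (hr i))).image _).subset this

theorem IsDiscretePos.mono {S T : Set ℝ} (hT : IsDiscretePos T) (h : S ⊆ T) : IsDiscretePos S :=
  fun a b ha => (hT a b ha).subset (Set.inter_subset_inter_left _ h)

/-- A function with values in a discrete set and bounded below by a positive number attains its
minimum. -/
theorem IsDiscretePos.exists_forall_le {S : Set ℝ} (hS : IsDiscretePos S) {α : Type*} {A : Set α}
    (hA : A.Nonempty) (f : α → ℝ) (hf : ∀ x ∈ A, f x ∈ S) {ε : ℝ} (hε : 0 < ε)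
    (hfε : ∀ x ∈ A, ε ≤ f x) : ∃ x ∈ A, ∀ y ∈ A, f x ≤ f y := by
  obtain ⟨x₀, hx₀⟩ := hA
  -- Only values not exceeding that of one chosen point compete, and these lie in a compact interval
  -- of (0, ∞).
  have hfin : (f '' A ∩ Set.Icc ε (f x₀)).Finite := by
    refine (hS ε (f x₀) hε).subset (Set.inter_subset_inter_left _ ?_)
    rintro _ ⟨x, hx, rfl⟩
    exact hf x hx
  obtain ⟨m, ⟨⟨x, hx, rfl⟩, hm⟩, hmin⟩ := hfin.exists_minimal
    ⟨f x₀, ⟨x₀, hx₀, rfl⟩, hfε x₀ hx₀, le_rfl⟩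
  refine ⟨x, hx, fun y hy => ?_⟩
  by_contra! h
  exact absurd (hmin ⟨⟨y, hy, rfl⟩, hfε y hy, (h.le.trans hm.2)⟩ h.le) (not_le.2 h)

section

variable {K : Type*} [NormedField K] {V : Type*} [NormedAddCommGroup V] [NormedSpace K V]

theorem IsNormOrthogonal.linearIndependent {ι : Type*} [Fintype ι] {b : ι → V}
    (hb : IsNormOrthogonal K b) (h0 : ∀ i, b i ≠ 0) : LinearIndependent K b := by
  rw [Fintype.linearIndependent_iff]
  intro c hc i
  have := hb c i
  rw [hc, norm_zero] at this
  have h1 := norm_pos_iff.2 (h0 i)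
  have h2 : ‖c i‖ ≤ 0 := by
    by_contra! h
    exact absurd this (not_le.2 (mul_pos h h1))
  exact norm_le_zero_iff.1 h2

/-- A linear functional on a space with an orthogonal basis is bounded. -/
theorem IsNormOrthogonal.exists_bound {ι : Type*} [Fintype ι] {b : ι → V}
    (hb : IsNormOrthogonal K b) (h0 : ∀ i, b i ≠ 0) (hspan : Submodule.span K (Set.range b) = ⊤)
    (f : V →ₗ[K] K) : ∃ C : ℝ, ∀ x, ‖f x‖ ≤ C * ‖x‖ := by
  refine ⟨∑ i, ‖f (b i)‖ / ‖b i‖, fun x => ?_⟩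
  obtain ⟨c, rfl⟩ := (Submodule.mem_span_range_iff_exists_fun K).1
    (hspan ▸ Submodule.mem_top : x ∈ Submodule.span K (Set.range b))
  rw [map_sum, Finset.sum_mul]
  refine (norm_sum_le _ _).trans (Finset.sum_le_sum fun i _ => ?_)
  have h1 := norm_pos_iff.2 (h0 i)
  rw [map_smul, norm_smul, div_mul_eq_mul_div, le_div_iff₀ h1]
  calc ‖c i‖ * ‖f (b i)‖ * ‖b i‖ = ‖f (b i)‖ * (‖c i‖ * ‖b i‖) := by ring
    _ ≤ _ := by gcongr; exact hb c i

variable [IsUltrametricDist V]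

/-- The norm of a linear combination of an orthogonal family is the norm of one of its terms. -/
theorem IsNormOrthogonal.exists_norm_eq {ι : Type*} [Fintype ι] {b : ι → V}
    (hb : IsNormOrthogonal K b) (c : ι → K) (hc : ∑ j, c j • b j ≠ 0) :
    ∃ i, c i ≠ 0 ∧ ‖∑ j, c j • b j‖ = ‖b i‖ * ‖c i‖ := by
  have hne : (Finset.univ : Finset ι).Nonempty := by
    rw [Finset.univ_nonempty_iff]
    by_contra h
    rw [not_nonempty_iff] at h
    exact hc (by simp)
  obtain ⟨i, -, hi⟩ := IsUltrametricDist.exists_norm_finsetSum_le_of_nonempty hne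
    (fun j => c j • b j)
  have h := le_antisymm hi ((norm_smul _ _).le.trans (hb c i))
  refine ⟨i, fun h0 => ?_, by rw [h, norm_smul, mul_comm]⟩
  rw [h0, zero_smul, norm_zero, norm_eq_zero] at h
  exact hc h

/-- Orthogonality bounds each coordinate by a multiple of the norm, so the coordinate
parametrisation is antilipschitz and carries completeness of `K` to the span. The span is therefore
closed, which keeps a vector outside it at positive distance. -/
theorem IsNormOrthogonal.isComplete_span [CompleteSpace K] {ι : Type*} [Fintype ι] {b : ι → V}
    (hb : IsNormOrthogonal K b) (h0 : ∀ i, b i ≠ 0) :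
    IsComplete (Submodule.span K (Set.range b) : Set V) := by
  let f : (ι → K) →ₗ[K] V := Fintype.linearCombination K b
  have hf : ∀ c, f c = ∑ i, c i • b i := fun c => by simp [f, Fintype.linearCombination_apply]
  obtain ⟨C, hC⟩ : ∃ C : NNReal, ∀ i, ‖b i‖⁻¹ ≤ C :=
    ⟨∑ i, ‖b i‖₊⁻¹, fun i => by
      have := Finset.single_le_sum (f := fun i => ‖b i‖₊⁻¹) (fun _ _ => zero_le) (Finset.mem_univ i)
      exact_mod_cast this⟩
  have hanti : AntilipschitzWith C f := by
    refine AddMonoidHomClass.antilipschitz_of_bound f fun c => ?_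
    rw [pi_norm_le_iff_of_nonneg (by positivity)]
    intro i
    have h1 := norm_pos_iff.2 (h0 i)
    have h2 := hb c i
    rw [← hf] at h2
    calc ‖c i‖ = ‖b i‖⁻¹ * (‖c i‖ * ‖b i‖) := by field_simp
      _ ≤ C * ‖f c‖ := by gcongr; exact hC i
  have hcont : UniformContinuous f := by
    have hcont' : Continuous f := by
      simp only [funext hf]
      fun_prop
    exact uniformContinuous_addMonoidHom_of_continuous (f := f.toAddMonoidHom) hcont'
  have := hanti.isComplete_range hcont
  rwa [← LinearMap.coe_range, Fintype.range_linearCombination] at this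

theorem IsNormOrthogonal.isDiscretePos {ι : Type*} [Fintype ι] {b : ι → V}
    (hb : IsNormOrthogonal K b) (h0 : ∀ i, b i ≠ 0) {S : Set ℝ} (hS : IsDiscretePos S)
    (hKS : ∀ c : K, c ≠ 0 → ‖c‖ ∈ S) :
    IsDiscretePos {r | ∃ x ∈ Submodule.span K (Set.range b), x ≠ 0 ∧ r = ‖x‖} := by
  refine (hS.biUnion_smul (fun i => ‖b i‖) fun i => norm_pos_iff.2 (h0 i)).mono ?_
  rintro _ ⟨x, hx, hx0, rfl⟩
  obtain ⟨c, rfl⟩ := (Submodule.mem_span_range_iff_exists_fun K).1 hx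
  obtain ⟨i, hi, h⟩ := hb.exists_norm_eq c hx0
  exact ⟨i, _, hKS _ hi, h⟩

/-- A vector outside the span of an orthogonal family has a best approximation in the span. -/
theorem IsNormOrthogonal.exists_best_approximation [CompleteSpace K] {ι : Type*} [Fintype ι]
    {b : ι → V} (hb : IsNormOrthogonal K b) (h0 : ∀ i, b i ≠ 0) {S : Set ℝ} (hS : IsDiscretePos S)
    (hKS : ∀ c : K, c ≠ 0 → ‖c‖ ∈ S) {v : V} (hv : v ∉ Submodule.span K (Set.range b)) :
    ∃ w ∈ Submodule.span K (Set.range b), ∀ w' ∈ Submodule.span K (Set.range b),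
      ‖v - w‖ ≤ ‖v - w'‖ := by
  set W := Submodule.span K (Set.range b)
  by_contra! hcon
  have hcl : IsClosed (W : Set V) := (hb.isComplete_span h0).isClosed
  have hpos := (hcl.notMem_iff_infDist_pos ⟨0, W.zero_mem⟩).1 hv
  -- If no approximation is best, each w is beaten by some w'. Then v - w and v - w' have different
  -- norms, so ‖v - w‖ = ‖w' - w‖, which is the norm of a nonzero vector of W. The distances thus
  -- lie in a discrete set and attain a minimum after all.
  have hval : ∀ w ∈ (W : Set V), ‖v - w‖ ∈ {r | ∃ x ∈ W, x ≠ 0 ∧ r = ‖x‖} := by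
    intro w hw
    obtain ⟨w', hw', h⟩ := hcon w hw
    have hne : ‖v - w‖ ≠ ‖v - w'‖ := h.ne'
    have heq : ‖w' - w‖ = ‖v - w‖ := by
      have h1 := IsUltrametricDist.norm_add_eq_max_of_norm_ne_norm (x := v - w) (y := -(v - w'))
        (by rwa [norm_neg])
      rw [norm_neg, max_eq_left h.le] at h1
      rw [← h1]
      congr 1
      abel
    refine ⟨w' - w, W.sub_mem hw' hw, fun h' => ?_, heq.symm⟩
    rw [sub_eq_zero] at h'
    exact hne (by rw [h'])
  obtain ⟨w, hw, hmin⟩ := (hb.isDiscretePos h0 hS hKS).exists_forall_le (A := (W : Set V))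
    ⟨0, W.zero_mem⟩ (fun w => ‖v - w‖) hval hpos (fun w hw => by
      rw [← dist_eq_norm]; exact Metric.infDist_le_dist_of_mem hw)
  obtain ⟨w', hw', h⟩ := hcon w hw
  exact absurd (hmin w' hw') (not_le.2 h)

/-- Scaling the minimality of `u` in its coset bounds the new term a • u by the whole sum x + a • u;
the ultrametric inequality then bounds x, and hence every old term. -/
theorem IsNormOrthogonal.snoc {n : ℕ} {b : Fin n → V} (hb : IsNormOrthogonal K b) {u : V}
    (hu : ∀ w ∈ Submodule.span K (Set.range b), ‖u‖ ≤ ‖u + w‖) :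
    IsNormOrthogonal K (Fin.snoc b u : Fin (n + 1) → V) := by
  intro c
  simp only [Fin.sum_univ_castSucc, Fin.snoc_castSucc, Fin.snoc_last]
  set x := ∑ i : Fin n, c i.castSucc • b i with hx
  have hxmem : x ∈ Submodule.span K (Set.range b) :=
    (Submodule.mem_span_range_iff_exists_fun K).2 ⟨_, rfl⟩
  set a := c (Fin.last n)
  have hlast : ‖a‖ * ‖u‖ ≤ ‖x + a • u‖ := by
    by_cases ha : a = 0
    · simp [ha]
    · have h := hu (a⁻¹ • x) (Submodule.smul_mem _ _ hxmem)
      calc ‖a‖ * ‖u‖ ≤ ‖a‖ * ‖u + a⁻¹ • x‖ := by gcongr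
        _ = ‖x + a • u‖ := by rw [← norm_smul, smul_add, smul_inv_smul₀ ha, add_comm]
  have hx_le : ‖x‖ ≤ ‖x + a • u‖ := by
    calc ‖x‖ = ‖(x + a • u) + -(a • u)‖ := by congr 1; abel
      _ ≤ max ‖x + a • u‖ ‖-(a • u)‖ := IsUltrametricDist.norm_add_le_max _ _
      _ ≤ ‖x + a • u‖ := max_le le_rfl (by rwa [norm_neg, norm_smul])
  intro i
  refine Fin.lastCases ?_ (fun i => ?_) i
  · simpa only [Fin.snoc_last] using hlast
  · simpa only [Fin.snoc_castSucc] using (hb (fun i => c i.castSucc) i).trans hx_le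

/-- A finite-dimensional ultrametric normed space over a complete field with discrete values has an
orthogonal basis. -/
theorem exists_isNormOrthogonal_basis [CompleteSpace K] [FiniteDimensional K V] {S : Set ℝ}
    (hS : IsDiscretePos S) (hKS : ∀ c : K, c ≠ 0 → ‖c‖ ∈ S) :
    ∃ b : Fin (Module.finrank K V) → V, IsNormOrthogonal K b ∧ (∀ i, b i ≠ 0) ∧
      Submodule.span K (Set.range b) = ⊤ := by
  have key : ∀ n ≤ Module.finrank K V, ∃ b : Fin n → V, IsNormOrthogonal K b ∧ ∀ i, b i ≠ 0 := by
    intro n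
    induction n with
    | zero => exact fun _ => ⟨Fin.elim0, fun _ i => i.elim0, fun i => i.elim0⟩
    | succ n ih =>
      intro hn
      obtain ⟨b, hb, h0⟩ := ih (by omega)
      obtain ⟨v, hv⟩ : ∃ v, v ∉ Submodule.span K (Set.range b) := by
        by_contra! hcon
        have h1 := finrank_range_le_card (R := K) b
        have h2 : Submodule.span K (Set.range b) = ⊤ := eq_top_iff.2 fun v _ => hcon v
        rw [Set.finrank, h2, finrank_top, Fintype.card_fin] at h1
        omega
      obtain ⟨w, hw, hmin⟩ := hb.exists_best_approximation h0 hS hKS hv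
      refine ⟨Fin.snoc b (v - w), hb.snoc fun x hx => ?_, fun i => ?_⟩
      · rw [sub_add]
        exact hmin _ (Submodule.sub_mem _ hw hx)
      · refine Fin.lastCases ?_ (fun i => ?_) i
        · rw [Fin.snoc_last, sub_ne_zero]
          rintro rfl
          exact hv hw
        · rw [Fin.snoc_castSucc]
          exact h0 i
  obtain ⟨b, hb, h0⟩ := key _ le_rfl
  exact ⟨b, hb, h0, (hb.linearIndependent h0).span_eq_top_of_card_eq_finrank' (by simp)⟩

end

/-! ### Successive minima -/

section

variable {R : Type*} [CommRing R] {H : Type*} [AddCommGroup H] [Module R H]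

/-- `e` is a system of successive minima of `D` modulo `T`: each `e i` minimises `D` outside the
submodule generated by `T` and the preceding terms. -/
def IsSuccessiveMinima (T : Submodule R H) (D : H → ℝ) {n : ℕ} (e : Fin n → H) : Prop :=
  ∀ i, e i ∉ T ⊔ Submodule.span R (e '' Set.Iio i) ∧
    ∀ y, y ∉ T ⊔ Submodule.span R (e '' Set.Iio i) → D (e i) ≤ D y

variable {T : Submodule R H} {D : H → ℝ}

/-- A later term already lay outside the smaller submodule used for an earlier choice, so it was a
candidate there. -/
theorem IsSuccessiveMinima.monotone {n : ℕ} {e : Fin n → H} (he : IsSuccessiveMinima T D e) :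
    Monotone fun i => D (e i) := by
  intro i j hij
  refine (he i).2 _ fun h => (he j).1 ?_
  have hle : T ⊔ Submodule.span R (e '' Set.Iio i) ≤ T ⊔ Submodule.span R (e '' Set.Iio j) :=
    sup_le_sup_left (Submodule.span_mono (Set.image_mono (Set.Iio_subset_Iio hij))) T
  exact hle h

theorem IsSuccessiveMinima.snoc {n : ℕ} {e : Fin n → H} (he : IsSuccessiveMinima T D e) {x : H}
    (hx : x ∉ T ⊔ Submodule.span R (Set.range e))
    (hmin : ∀ y, y ∉ T ⊔ Submodule.span R (Set.range e) → D x ≤ D y) :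
    IsSuccessiveMinima T D (Fin.snoc e x : Fin (n + 1) → H) := by
  have himg : ∀ i : Fin (n + 1), (Fin.snoc e x : Fin (n + 1) → H) '' Set.Iio i =
      e '' {j | j.castSucc < i} := by
    intro i
    ext y
    constructor
    · rintro ⟨j, hj, rfl⟩
      have hjn : j ≠ Fin.last n := fun h => absurd (Fin.le_last i) (not_le.2 (h ▸ hj))
      obtain ⟨k, rfl⟩ := Fin.exists_castSucc_eq.2 hjn
      exact ⟨k, hj, by simp⟩
    · rintro ⟨j, hj, rfl⟩
      exact ⟨j.castSucc, hj, by simp⟩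
  intro i
  rw [himg]
  refine Fin.lastCases ?_ (fun i => ?_) i
  · have : {j : Fin n | j.castSucc < Fin.last n} = Set.univ := by
      ext j; simp [Fin.castSucc_lt_last]
    rw [this, Set.image_univ, Fin.snoc_last]
    exact ⟨hx, hmin⟩
  · rw [Fin.snoc_castSucc]
    exact he i

/-- Greedy choice: a system that does not yet generate everything modulo `T` can be prolonged by a
minimiser, and the bound `N` on lengths forces this to stop. -/
theorem exists_isSuccessiveMinima
    (hmin : ∀ A : Set H, A.Nonempty → (∀ x ∈ A, x ∉ T) → ∃ x ∈ A, ∀ y ∈ A, D x ≤ D y)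
    {N : ℕ} (hN : ∀ (n : ℕ) (e : Fin n → H), IsSuccessiveMinima T D e → n ≤ N) :
    ∃ (n : ℕ) (e : Fin n → H), IsSuccessiveMinima T D e ∧
      T ⊔ Submodule.span R (Set.range e) = ⊤ := by
  by_contra! hcon
  have key : ∀ n, ∃ e : Fin n → H, IsSuccessiveMinima T D e := by
    intro n
    induction n with
    | zero => exact ⟨Fin.elim0, fun i => i.elim0⟩
    | succ n ih =>
      obtain ⟨e, he⟩ := ih
      obtain ⟨x, hx, hle⟩ := hmin {x | x ∉ T ⊔ Submodule.span R (Set.range e)} (by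
        by_contra h
        rw [Set.not_nonempty_iff_eq_empty, Set.eq_empty_iff_forall_notMem] at h
        exact hcon n e he (eq_top_iff.2 fun x _ => not_not.1 (h x)))
        fun x hx hxT => hx (Submodule.mem_sup_left hxT)
      exact ⟨_, he.snoc hx hle⟩
  obtain ⟨e, he⟩ := key (N + 1)
  have := hN _ e he
  omega

variable {K₁ K₂ : Type*} [NormedField K₁] [NormedField K₂] [Algebra R K₁] [Algebra R K₂]
  {V₁ V₂ : Type*} [NormedAddCommGroup V₁] [NormedSpace K₁ V₁] [IsUltrametricDist V₁]
  [NormedAddCommGroup V₂] [NormedSpace K₂ V₂] [IsUltrametricDist V₂]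
  [Module R V₁] [IsScalarTower R K₁ V₁] [Module R V₂] [IsScalarTower R K₂ V₂]

/-- Successive minima of the product of two norms are orthogonal for the first norm, provided that
the elements of the first field have leading monomials on which the two absolute values are inverse
to each other. -/
theorem IsSuccessiveMinima.isNormOrthogonal {φ₁ : H →ₗ[R] V₁} {φ₂ : H →ₗ[R] V₂}
    (hlead : ∀ c : K₁, c ≠ 0 → ∃ m : Rˣ, ‖c - algebraMap R K₁ m‖ < ‖c‖ ∧
      ‖algebraMap R K₁ m‖ = ‖c‖ ∧ ‖algebraMap R K₁ m‖ * ‖algebraMap R K₂ m‖ = 1)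
    (h₁ : ∀ x, x ∉ T → φ₁ x ≠ 0) (h₂ : ∀ x, x ∉ T → φ₂ x ≠ 0) {n : ℕ} {e : Fin n → H}
    (he : IsSuccessiveMinima T (fun x => ‖φ₁ x‖ * ‖φ₂ x‖) e) :
    IsNormOrthogonal K₁ fun i => φ₁ (e i) := by
  classical
  intro c
  by_contra! hcon
  have heT : ∀ i, e i ∉ T := fun i h => (he i).1 (Submodule.mem_sup_left h)
  obtain ⟨i₀, hi₀⟩ := hcon
  have : Nonempty (Fin n) := ⟨i₀⟩
  obtain ⟨j₀, hj₀⟩ := Finite.exists_max fun i => ‖c i‖ * ‖φ₁ (e i)‖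
  set s := ‖c j₀‖ * ‖φ₁ (e j₀)‖ with hs
  have hlt : ‖∑ j, c j • φ₁ (e j)‖ < s := hi₀.trans_le (hj₀ i₀)
  have hs0 : 0 < s := (norm_nonneg _).trans_lt hlt
  -- The terms of maximal size s; only they can be responsible for the cancellation.
  let I : Finset (Fin n) := Finset.univ.filter fun i => ‖c i‖ * ‖φ₁ (e i)‖ = s
  have hI : ∀ i, i ∈ I ↔ ‖c i‖ * ‖φ₁ (e i)‖ = s := fun i => by simp [I]
  have hIne : I.Nonempty := ⟨j₀, (hI _).2 rfl⟩
  have hcI : ∀ i ∈ I, c i ≠ 0 := by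
    intro i hi h0
    rw [hI, h0, norm_zero, zero_mul] at hi
    exact hs0.ne hi
  have hm : ∀ i, ∃ m : Rˣ, i ∈ I → ‖c i - algebraMap R K₁ m‖ < ‖c i‖ ∧
      ‖algebraMap R K₁ m‖ = ‖c i‖ ∧ ‖algebraMap R K₁ m‖ * ‖algebraMap R K₂ m‖ = 1 := by
    intro i
    by_cases hi : i ∈ I
    · obtain ⟨m, h⟩ := hlead _ (hcI i hi)
      exact ⟨m, fun _ => h⟩
    · exact ⟨1, fun h => absurd h hi⟩
  choose m hm using hm
  set y : H := ∑ i ∈ I, (m i : R) • e i with hy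
  set k := I.max' hIne with hk
  have hkI : k ∈ I := I.max'_mem hIne
  -- All other indices in I precede k, and m k is a unit, so membership of y would force membership
  -- of e k.
  have hyk : y ∉ T ⊔ Submodule.span R (e '' Set.Iio k) := by
    intro hmem
    refine (he k).1 ?_
    rw [hy, ← Finset.add_sum_erase _ _ hkI] at hmem
    have hrest : ∑ i ∈ I.erase k, (m i : R) • e i ∈ T ⊔ Submodule.span R (e '' Set.Iio k) := by
      refine Submodule.sum_mem _ fun i hi => Submodule.smul_mem _ _
        (Submodule.mem_sup_right (Submodule.subset_span ⟨i, ?_, rfl⟩))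
      exact lt_of_le_of_ne (I.le_max' i (Finset.mem_of_mem_erase hi)) (Finset.ne_of_mem_erase hi)
    have h := (Submodule.add_mem_iff_left _ hrest).1 hmem
    have h' := Submodule.smul_mem _ ((m k)⁻¹ : Rˣ).1 h
    rwa [smul_smul, Units.inv_mul, one_smul] at h'
  have hDk : 0 < ‖φ₁ (e k)‖ * ‖φ₂ (e k)‖ :=
    mul_pos (norm_pos_iff.2 (h₁ _ (heT k))) (norm_pos_iff.2 (h₂ _ (heT k)))
  -- φ₁ y differs from the small sum by terms that are all below s: outside I the terms are not
  -- maximal, and inside I removing the leading monomial strictly decreases the coefficient.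
  have hy1 : ‖φ₁ y‖ < s := by
    have hdecomp : φ₁ y = ∑ j, c j • φ₁ (e j) +
        ∑ j, -(if j ∈ I then c j - algebraMap R K₁ (m j) else c j) • φ₁ (e j) := by
      rw [← Finset.sum_add_distrib, hy, map_sum, ← Finset.sum_filter_add_sum_filter_not
        Finset.univ (· ∈ I)]
      have hI' : Finset.univ.filter (· ∈ I) = I := by ext; simp
      rw [hI', Finset.sum_eq_zero (s := Finset.univ.filter (· ∉ I)), add_zero]
      · refine Finset.sum_congr rfl fun i hi => ?_
        rw [if_pos hi, ← add_smul, map_smul, ← algebraMap_smul K₁ (m i : R)]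
        congr 1
        ring
      · intro i hi
        rw [if_neg (Finset.mem_filter.1 hi).2, ← add_smul, add_neg_cancel, zero_smul]
    rw [hdecomp]
    refine (IsUltrametricDist.norm_add_le_max _ _).trans_lt (max_lt hlt ?_)
    obtain ⟨i, -, hi⟩ := IsUltrametricDist.exists_norm_finsetSum_le_of_nonempty
      Finset.univ_nonempty
      (fun j => -(if j ∈ I then c j - algebraMap R K₁ (m j) else c j) • φ₁ (e j))
    refine hi.trans_lt ?_
    rw [norm_smul, norm_neg]
    by_cases hiI : i ∈ I
    · rw [if_pos hiI, ← (hI i).1 hiI]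
      exact mul_lt_mul_of_pos_right (hm i hiI).1 (norm_pos_iff.2 (h₁ _ (heT i)))
    · rw [if_neg hiI]
      exact lt_of_le_of_ne (hj₀ i) fun h => hiI ((hI i).2 h)
  -- Since the two norms of m i are inverse, ‖m i‖₂ ‖φ₂ (e i)‖ = D(e i)/s for i in I, and D(e i) ≤
  -- D(e k) by monotonicity.
  have hy2 : ‖φ₂ y‖ ≤ ‖φ₁ (e k)‖ * ‖φ₂ (e k)‖ / s := by
    rw [hy, map_sum]
    obtain ⟨i, hiI, hi⟩ := IsUltrametricDist.exists_norm_finsetSum_le_of_nonempty hIne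
      (fun j => φ₂ ((m j : R) • e j))
    refine hi.trans ?_
    obtain ⟨-, hm1, hm2⟩ := hm i hiI
    rw [map_smul, ← algebraMap_smul K₂ (m i : R), norm_smul, le_div_iff₀ hs0, ← (hI i).1 hiI, ← hm1]
    calc _ = (‖algebraMap R K₁ (m i)‖ * ‖algebraMap R K₂ (m i)‖) *
          (‖φ₁ (e i)‖ * ‖φ₂ (e i)‖) := by ring
      _ = ‖φ₁ (e i)‖ * ‖φ₂ (e i)‖ := by rw [hm2, one_mul]
      _ ≤ _ := he.monotone (I.le_max' i hiI)
  have h := (he k).2 y hyk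
  have hy0 : 0 < ‖φ₂ y‖ := by
    refine norm_pos_iff.2 (h₂ _ fun h => hyk (Submodule.mem_sup_left h))
  have : ‖φ₁ y‖ * ‖φ₂ y‖ < s * (‖φ₁ (e k)‖ * ‖φ₂ (e k)‖ / s) :=
    mul_lt_mul hy1 hy2 hy0 hs0.le
  rw [mul_div_cancel₀ _ hs0.ne'] at this
  exact absurd h (not_le.2 this)

end

/-! ### Novikov fields as complete normed fields -/

section

variable {κ : Type*} [Field κ] {G : Type*} [AddCommGroup G] [LinearOrder G]

/-- A strictly descending sequence would put infinitely many elements below one bound. This makes a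
coefficientwise limit a legitimate Hahn series. -/
theorem isPWO_of_finite_lt {v : G →+ ℝ} {s : Set G} (hs : ∀ C : ℝ, {g | g ∈ s ∧ v g < C}.Finite)
    (hv : StrictMono v) : s.IsPWO := by
  rw [Set.isPWO_iff_isWF, Set.isWF_iff_no_descending_seq]
  intro f hf hmem
  have hfin := (hs (v (f 0) + 1)).preimage (f := f) hf.injective.injOn
  refine Set.infinite_univ (hfin.subset fun n _ => ⟨hmem n, ?_⟩)
  have := hv.monotone (hf.antitone (Nat.zero_le n))
  linarith

open Classical in
/-- The function `exp (-v (order x))` on Hahn series, with value `0` at `0`. -/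
noncomputable def hahnNorm (v : G →+ ℝ) (x : HahnSeries G κ) : ℝ :=
  if x = 0 then 0 else Real.exp (-v x.order)

theorem hahnNorm_zero (v : G →+ ℝ) : hahnNorm v (0 : HahnSeries G κ) = 0 :=
  if_pos rfl

theorem hahnNorm_of_ne_zero (v : G →+ ℝ) {x : HahnSeries G κ} (hx : x ≠ 0) :
    hahnNorm v x = Real.exp (-v x.order) :=
  if_neg hx

theorem hahnNorm_nonneg (v : G →+ ℝ) (x : HahnSeries G κ) : 0 ≤ hahnNorm v x := by
  by_cases hx : x = 0
  · rw [hx, hahnNorm_zero]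
  · rw [hahnNorm_of_ne_zero v hx]
    exact (Real.exp_pos _).le

theorem hahnNorm_add_le (v : G →+ ℝ) (hv : StrictMono v) (x y : HahnSeries G κ) :
    hahnNorm v (x + y) ≤ max (hahnNorm v x) (hahnNorm v y) := by
  by_cases hx : x = 0
  · rw [hx, zero_add]
    exact le_max_right _ _
  by_cases hy : y = 0
  · rw [hy, add_zero]
    exact le_max_left _ _
  by_cases hxy : x + y = 0
  · rw [hxy, hahnNorm_zero]
    exact le_max_of_le_left (hahnNorm_nonneg v x)
  rw [hahnNorm_of_ne_zero v hx, hahnNorm_of_ne_zero v hy, hahnNorm_of_ne_zero v hxy]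
  rcases min_le_iff.1 (HahnSeries.min_order_le_order_add hxy) with h | h
  · exact le_max_of_le_left (Real.exp_le_exp.2 (neg_le_neg (hv.monotone h)))
  · exact le_max_of_le_right (Real.exp_le_exp.2 (neg_le_neg (hv.monotone h)))

variable [IsOrderedAddMonoid G]

/-- The absolute value `exp (-v (order x))` on Hahn series. -/
noncomputable def hahnAbs (κ : Type*) [Field κ] {G : Type*} [AddCommGroup G] [LinearOrder G]
    [IsOrderedAddMonoid G] (v : G →+ ℝ) (hv : StrictMono v) : AbsoluteValue (HahnSeries G κ) ℝ where
  toFun := hahnNorm v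
  map_mul' x y := by
    by_cases hx : x = 0
    · rw [hx, zero_mul, hahnNorm_zero, zero_mul]
    by_cases hy : y = 0
    · rw [hy, mul_zero, hahnNorm_zero, mul_zero]
    rw [hahnNorm_of_ne_zero v hx, hahnNorm_of_ne_zero v hy,
      hahnNorm_of_ne_zero v (mul_ne_zero hx hy), HahnSeries.order_mul hx hy, map_add, neg_add,
      Real.exp_add]
  nonneg' := hahnNorm_nonneg v
  eq_zero' x := by
    refine ⟨fun h => ?_, fun h => by rw [h, hahnNorm_zero]⟩
    by_contra hx
    rw [hahnNorm_of_ne_zero v hx] at h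
    exact (Real.exp_pos _).ne' h
  add_le' x y := (hahnNorm_add_le v hv x y).trans
    (max_le_add_of_nonneg (hahnNorm_nonneg v x) (hahnNorm_nonneg v y))

variable (v : G →+ ℝ) (hv : StrictMono v)

theorem hahnAbs_of_ne_zero {x : HahnSeries G κ} (hx : x ≠ 0) :
    hahnAbs κ v hv x = Real.exp (-v x.order) :=
  hahnNorm_of_ne_zero v hx

theorem exp_le_hahnAbs {x : HahnSeries G κ} {g : G} (hg : x.coeff g ≠ 0) :
    Real.exp (-v g) ≤ hahnAbs κ v hv x := by
  have hx : x ≠ 0 := by rintro rfl; exact hg rfl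
  rw [hahnAbs_of_ne_zero v hv hx]
  exact Real.exp_le_exp.2 (neg_le_neg (hv.monotone (HahnSeries.order_le_of_coeff_ne_zero hg)))

theorem exists_hahnAbs_eq {x : HahnSeries G κ} (hx : x ≠ 0) :
    ∃ g, x.coeff g ≠ 0 ∧ hahnAbs κ v hv x = Real.exp (-v g) :=
  ⟨x.order, HahnSeries.coeff_order_eq_zero.not.2 hx, hahnAbs_of_ne_zero v hv hx⟩

theorem hahnAbs_lt_of_coeff_eq_zero {x : HahnSeries G κ} {C : ℝ}
    (h : ∀ g, v g ≤ C → x.coeff g = 0) : hahnAbs κ v hv x < Real.exp (-C) := by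
  by_cases hx : x = 0
  · rw [hx, map_zero]
    exact Real.exp_pos _
  · obtain ⟨g, hg, h'⟩ := exists_hahnAbs_eq v hv hx
    rw [h']
    refine Real.exp_lt_exp.2 (neg_lt_neg ?_)
    by_contra! hle
    exact hg (h g hle)

theorem coeff_eq_of_hahnAbs_sub_lt {x y : HahnSeries G κ} {g : G}
    (h : hahnAbs κ v hv (x - y) < Real.exp (-v g)) : x.coeff g = y.coeff g := by
  by_contra hne
  refine absurd (exp_le_hahnAbs v hv (x := x - y) (g := g) ?_) (not_le.2 h)
  rwa [HahnSeries.coeff_sub, sub_ne_zero]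

/-- Subtracting the leading monomial of a nonzero Hahn series decreases its absolute value. -/
theorem hahnAbs_sub_leading_lt {x : HahnSeries G κ} (hx : x ≠ 0) :
    hahnAbs κ v hv (x - HahnSeries.single x.order x.leadingCoeff) < hahnAbs κ v hv x := by
  by_cases h0 : x - HahnSeries.single x.order x.leadingCoeff = 0
  · rw [h0, map_zero]
    exact (hahnAbs κ v hv).pos hx
  obtain ⟨g, hg, h⟩ := exists_hahnAbs_eq v hv h0
  rw [h, hahnAbs_of_ne_zero v hv hx]
  refine Real.exp_lt_exp.2 (neg_lt_neg (hv ?_))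
  have hne : g ≠ x.order := by
    rintro rfl
    exact hg (by rw [HahnSeries.coeff_sub, HahnSeries.coeff_single_same,
      HahnSeries.leadingCoeff_eq, sub_self])
  rw [HahnSeries.coeff_sub, HahnSeries.coeff_single_of_ne hne, sub_zero] at hg
  exact lt_of_le_of_ne (HahnSeries.order_le_of_coeff_ne_zero hg) hne.symm

/-- The absolute value on a Novikov field. -/
noncomputable def novikovAbs (κ : Type*) [Field κ] {G : Type*} [AddCommGroup G] [LinearOrder G]
    [IsOrderedAddMonoid G] (v : G →+ ℝ) (hv : StrictMono v) :
    AbsoluteValue (novikovSubfield κ v hv) ℝ :=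
  (hahnAbs κ v hv).comp (f := (novikovSubfield κ v hv).subtype) Subtype.val_injective

/-- A Novikov field with its absolute value as a normed field. -/
noncomputable abbrev novikovNormedField (κ : Type*) [Field κ] {G : Type*} [AddCommGroup G]
    [LinearOrder G] [IsOrderedAddMonoid G] (v : G →+ ℝ) (hv : StrictMono v) :
    NormedField (novikovSubfield κ v hv) :=
  (novikovAbs κ v hv).toNormedField

/-- Along a Cauchy sequence, the coefficients at exponents up to any bound C are eventually
constant. The limit agrees up to C with a single term of the sequence, from which it inherits the
finiteness condition. -/
theorem completeSpace_novikov :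
    letI := novikovNormedField κ v hv
    CompleteSpace (novikovSubfield κ v hv) := by
  let _ := novikovNormedField κ v hv
  have hdist : ∀ x y : novikovSubfield κ v hv, dist x y = hahnAbs κ v hv (x.1 - y.1) :=
    fun x y => dist_eq_norm x y
  refine Metric.complete_of_cauchySeq_tendsto fun u hu => ?_
  have hu' : ∀ C : ℝ, ∃ N, ∀ n ≥ N, ∀ g, v g ≤ C → (u n).1.coeff g = (u N).1.coeff g := by
    intro C
    obtain ⟨N, hN⟩ := Metric.cauchySeq_iff'.1 hu (Real.exp (-C)) (Real.exp_pos _)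
    refine ⟨N, fun n hn g hg => coeff_eq_of_hahnAbs_sub_lt v hv ?_⟩
    rw [← hdist]
    exact (hN n hn).trans_le (Real.exp_le_exp.2 (neg_le_neg hg))
  choose N hN using hu'
  let a : G → κ := fun g => (u (N (v g))).1.coeff g
  have ha : ∀ C, ∀ g, v g ≤ C → a g = (u (N C)).1.coeff g := by
    intro C g hg
    rw [← hN C (max (N C) (N (v g))) (le_max_left _ _) g hg,
      hN (v g) (max (N C) (N (v g))) (le_max_right _ _) g le_rfl]
  have hfin : ∀ C : ℝ, {g | a g ≠ 0 ∧ v g < C}.Finite := by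
    intro C
    refine ((u (N C)).2 C).subset ?_
    rintro g ⟨hg, hC⟩
    exact ⟨by rwa [← ha C g hC.le], hC⟩
  let x : novikovSubfield κ v hv := ⟨⟨a, isPWO_of_finite_lt hfin hv⟩, hfin⟩
  refine ⟨x, Metric.tendsto_atTop.2 fun ε hε => ⟨N (-Real.log ε), fun n hn => ?_⟩⟩
  rw [hdist]
  have h := hahnAbs_lt_of_coeff_eq_zero v hv (x := (u n).1 - x.1) (C := -Real.log ε) fun g hg => by
    rw [HahnSeries.coeff_sub, hN _ n hn g hg, sub_eq_zero]
    exact (ha _ g hg).symm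
  rwa [neg_neg, Real.exp_log hε] at h

end

theorem AddSubgroup.subtype_strictMono (Γ : AddSubgroup ℝ) : StrictMono Γ.subtype :=
  Subtype.strictMono_coe _

section

variable {κ : Type*} [Field κ] {Γ : AddSubgroup ℝ}

noncomputable instance instNormedFieldNovikovUp : NormedField (NovikovUp κ Γ) :=
  { novikovNormedField κ Γ.subtype Γ.subtype_strictMono with
    toField := instFieldNovikovUp κ Γ }

noncomputable instance instNormedFieldNovikovDown : NormedField (NovikovDown κ Γ) :=
  { novikovNormedField κ (dualVal Γ) (dualVal_strictMono Γ) with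
    toField := instFieldNovikovDown κ Γ }

instance instCompleteSpaceNovikovUp : CompleteSpace (NovikovUp κ Γ) :=
  completeSpace_novikov Γ.subtype Γ.subtype_strictMono

instance instCompleteSpaceNovikovDown : CompleteSpace (NovikovDown κ Γ) :=
  completeSpace_novikov (dualVal Γ) (dualVal_strictMono Γ)

theorem NovikovUp.norm_def (x : NovikovUp κ Γ) :
    ‖x‖ = hahnAbs κ Γ.subtype Γ.subtype_strictMono x.1 := rfl

theorem NovikovDown.norm_def (x : NovikovDown κ Γ) :
    ‖x‖ = hahnAbs κ (dualVal Γ) (dualVal_strictMono Γ) x.1 := rfl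

end

/-! ### Detecting torsion by functionals -/

/-- On a finitely generated module over a domain, finitely many functionals vanish simultaneously
only on torsion elements. -/
theorem exists_functionals_detecting_torsion (R H : Type*) [CommRing R] [IsDomain R]
    [AddCommGroup H] [Module R H] [Module.Finite R H] :
    ∃ (n : ℕ) (l : Fin n → H →ₗ[R] R), ∀ x ∉ Submodule.torsion R H, ∃ j, l j x ≠ 0 := by
  classical
  let K := Localization (nonZeroDivisors R)
  let L := LocalizedModule (nonZeroDivisors R) H
  let ι : H →ₗ[R] L := LocalizedModule.mkLinearMap (nonZeroDivisors R) H
  have : Module.Finite K L := Module.Finite.of_isLocalizedModule (nonZeroDivisors R) ι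
  let : Field K := inferInstanceAs (Field (FractionRing R))
  let b := Module.finBasis K L
  obtain ⟨s, hs⟩ := (Module.Finite.fg_top : (⊤ : Submodule R H).FG)
  -- A common denominator for the coordinates of the finitely many generators; d times each
  -- coordinate functional then takes values in R on all of H.
  obtain ⟨d, hd⟩ := IsLocalization.exist_integer_multiples_of_finset (nonZeroDivisors R)
    ((s ×ˢ Finset.univ).image fun p : H × Fin (Module.finrank K L) => b.coord p.2 (ι p.1))
  let q : Fin (Module.finrank K L) → H →ₗ[R] K := fun j =>
    (d : R) • ((b.coord j).restrictScalars R ∘ₗ ι)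
  have hq : ∀ j x, q j x ∈ LinearMap.range (Algebra.linearMap R K) := by
    intro j x
    have hle : (⊤ : Submodule R H) ≤ (LinearMap.range (Algebra.linearMap R K)).comap (q j) := by
      rw [← hs, Submodule.span_le]
      intro h hh
      obtain ⟨r, hr⟩ := hd _ (Finset.mem_image.2 ⟨(h, j), by simpa using hh, rfl⟩)
      exact ⟨r, hr⟩
    exact hle (Submodule.mem_top (x := x))
  have hinj : Function.Injective (Algebra.linearMap R K) :=
    IsLocalization.injective K (le_refl (nonZeroDivisors R))
  let E := LinearEquiv.ofInjective (Algebra.linearMap R K) hinj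
  refine ⟨_, fun j => E.symm.toLinearMap ∘ₗ (q j).codRestrict _ (hq j), fun x hx => ?_⟩
  by_contra! hcon
  have hzero : ∀ j, b.coord j (ι x) = 0 := by
    intro j
    have h1 : (q j).codRestrict _ (hq j) x = 0 := E.symm.map_eq_zero_iff.1 (hcon j)
    have h2 : (d : R) • b.coord j (ι x) = 0 := congrArg Subtype.val h1
    rw [Algebra.smul_def] at h2
    refine (mul_eq_zero.1 h2).resolve_left fun h3 => nonZeroDivisors.ne_zero d.2 (hinj ?_)
    rw [map_zero]
    exact h3
  have hx0 : ι x = 0 := b.forall_coord_eq_zero_iff.1 hzero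
  refine hx ?_
  -- The kernel of the localisation map consists of torsion elements.
  have h : LocalizedModule.mk x (1 : nonZeroDivisors R) = LocalizedModule.mk 0 1 := by
    rw [LocalizedModule.zero_mk]
    exact hx0
  obtain ⟨u, hu⟩ := LocalizedModule.mk_eq.1 h
  exact (Submodule.mem_torsion_iff x).2 ⟨u, by simpa using hu⟩

/-! ### Simultaneous orthogonalisation -/

/-- The axiomatic form of the argument, symmetric in the two fields except that the first one bounds
the length of the system. -/
theorem exists_isNormOrthogonal_both {R : Type*} [CommRing R] {H : Type*} [AddCommGroup H]
    [Module R H] {T : Submodule R H} {K₁ K₂ : Type*} [NormedField K₁] [NormedField K₂]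
    [CompleteSpace K₁] [CompleteSpace K₂] [Algebra R K₁] [Algebra R K₂]
    {V₁ V₂ : Type*} [NormedAddCommGroup V₁] [NormedSpace K₁ V₁] [IsUltrametricDist V₁]
    [NormedAddCommGroup V₂] [NormedSpace K₂ V₂] [IsUltrametricDist V₂]
    [FiniteDimensional K₁ V₁] [FiniteDimensional K₂ V₂]
    [Module R V₁] [IsScalarTower R K₁ V₁] [Module R V₂] [IsScalarTower R K₂ V₂]
    (φ₁ : H →ₗ[R] V₁) (φ₂ : H →ₗ[R] V₂)
    {S : Set ℝ} (hS : IsDiscretePos S) (hSmul : ∀ x ∈ S, ∀ y ∈ S, x * y ∈ S)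
    (hS₁ : ∀ c : K₁, c ≠ 0 → ‖c‖ ∈ S) (hS₂ : ∀ c : K₂, c ≠ 0 → ‖c‖ ∈ S)
    (hlead₁ : ∀ c : K₁, c ≠ 0 → ∃ m : Rˣ, ‖c - algebraMap R K₁ m‖ < ‖c‖ ∧
      ‖algebraMap R K₁ m‖ = ‖c‖ ∧ ‖algebraMap R K₁ m‖ * ‖algebraMap R K₂ m‖ = 1)
    (hlead₂ : ∀ c : K₂, c ≠ 0 → ∃ m : Rˣ, ‖c - algebraMap R K₂ m‖ < ‖c‖ ∧
      ‖algebraMap R K₂ m‖ = ‖c‖ ∧ ‖algebraMap R K₂ m‖ * ‖algebraMap R K₁ m‖ = 1)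
    (hone : ∀ a : R, a ≠ 0 → 1 ≤ ‖algebraMap R K₁ a‖ * ‖algebraMap R K₂ a‖)
    {n : ℕ} (l : Fin n → H →ₗ[R] R) (hl : ∀ x ∉ T, ∃ j, l j x ≠ 0)
    (l₁ : Fin n → V₁ →ₗ[K₁] K₁) (hl₁ : ∀ j x, l₁ j (φ₁ x) = algebraMap R K₁ (l j x))
    (l₂ : Fin n → V₂ →ₗ[K₂] K₂) (hl₂ : ∀ j x, l₂ j (φ₂ x) = algebraMap R K₂ (l j x)) :
    ∃ (d : ℕ) (e : Fin d → H), (IsNormOrthogonal K₁ fun i => φ₁ (e i)) ∧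
      (IsNormOrthogonal K₂ fun i => φ₂ (e i)) ∧ (∀ i, φ₁ (e i) ≠ 0) ∧ (∀ i, φ₂ (e i) ≠ 0) ∧
      T ⊔ Submodule.span R (Set.range e) = ⊤ := by
  obtain ⟨b₁, hb₁, hb₁0, hspan₁⟩ := exists_isNormOrthogonal_basis (V := V₁) hS hS₁
  obtain ⟨b₂, hb₂, hb₂0, hspan₂⟩ := exists_isNormOrthogonal_basis (V := V₂) hS hS₂
  choose C₁ hC₁ using fun j => hb₁.exists_bound hb₁0 hspan₁ (l₁ j)
  choose C₂ hC₂ using fun j => hb₂.exists_bound hb₂0 hspan₂ (l₂ j)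
  have hbound : ∀ x ∉ T, ∃ j, 1 ≤ (C₁ j * C₂ j) * (‖φ₁ x‖ * ‖φ₂ x‖) := by
    intro x hx
    obtain ⟨j, hj⟩ := hl x hx
    refine ⟨j, (hone _ hj).trans ?_⟩
    rw [← hl₁, ← hl₂]
    calc _ ≤ (C₁ j * ‖φ₁ x‖) * (C₂ j * ‖φ₂ x‖) :=
          mul_le_mul (hC₁ _ _) (hC₂ _ _) (norm_nonneg _) ((norm_nonneg _).trans (hC₁ j _))
      _ = _ := by ring
  have hpos : ∀ x ∉ T, 0 < ‖φ₁ x‖ * ‖φ₂ x‖ := by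
    intro x hx
    obtain ⟨j, hj⟩ := hbound x hx
    refine lt_of_le_of_ne (by positivity) fun h => ?_
    rw [← h, mul_zero] at hj
    linarith
  have h₁ : ∀ x, x ∉ T → φ₁ x ≠ 0 := fun x hx h => by
    have := hpos x hx
    rw [h, norm_zero, zero_mul] at this
    exact lt_irrefl _ this
  have h₂ : ∀ x, x ∉ T → φ₂ x ≠ 0 := fun x hx h => by
    have := hpos x hx
    rw [h, norm_zero, mul_zero] at this
    exact lt_irrefl _ this
  -- Each norm is that of a basis vector times an element of S, and S is closed under products.
  have hval : ∀ x, x ∉ T → ‖φ₁ x‖ * ‖φ₂ x‖ ∈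
      {r | ∃ p : Fin (Module.finrank K₁ V₁) × Fin (Module.finrank K₂ V₂), ∃ s ∈ S,
        r = (‖b₁ p.1‖ * ‖b₂ p.2‖) * s} := by
    intro x hx
    obtain ⟨c, hc⟩ := (Submodule.mem_span_range_iff_exists_fun K₁).1
      (hspan₁ ▸ Submodule.mem_top : φ₁ x ∈ Submodule.span K₁ (Set.range b₁))
    obtain ⟨c', hc'⟩ := (Submodule.mem_span_range_iff_exists_fun K₂).1
      (hspan₂ ▸ Submodule.mem_top : φ₂ x ∈ Submodule.span K₂ (Set.range b₂))
    obtain ⟨i, hi0, hi⟩ := hb₁.exists_norm_eq c (hc ▸ h₁ x hx)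
    obtain ⟨j, hj0, hj⟩ := hb₂.exists_norm_eq c' (hc' ▸ h₂ x hx)
    refine ⟨(i, j), _, hSmul _ (hS₁ _ hi0) _ (hS₂ _ hj0), ?_⟩
    rw [← hc, ← hc', hi, hj]
    ring
  have hdisc := hS.biUnion_smul
    (fun p : Fin (Module.finrank K₁ V₁) × Fin (Module.finrank K₂ V₂) => ‖b₁ p.1‖ * ‖b₂ p.2‖)
    fun p => mul_pos (norm_pos_iff.2 (hb₁0 _)) (norm_pos_iff.2 (hb₂0 _))
  -- One constant dominating every C₁ j * C₂ j; the summand 1 keeps it positive even if there are no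
  -- functionals.
  set M : ℝ := 1 + ∑ j, |C₁ j * C₂ j| with hM
  have hM0 : 0 < M := by positivity
  have hlower : ∀ x ∉ T, M⁻¹ ≤ ‖φ₁ x‖ * ‖φ₂ x‖ := by
    intro x hx
    obtain ⟨j, hj⟩ := hbound x hx
    rw [inv_le_iff_one_le_mul₀ hM0, mul_comm]
    refine hj.trans (mul_le_mul_of_nonneg_right ?_ (hpos x hx).le)
    have := Finset.single_le_sum (f := fun j => |C₁ j * C₂ j|) (fun _ _ => abs_nonneg _)
      (Finset.mem_univ j)
    have := le_abs_self (C₁ j * C₂ j)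
    linarith
  have horth : ∀ (d : ℕ) (e : Fin d → H),
      IsSuccessiveMinima T (fun x => ‖φ₁ x‖ * ‖φ₂ x‖) e →
        (IsNormOrthogonal K₁ fun i => φ₁ (e i)) ∧ ∀ i, e i ∉ T := fun d e he =>
    ⟨he.isNormOrthogonal hlead₁ h₁ h₂, fun i h => (he i).1 (Submodule.mem_sup_left h)⟩
  obtain ⟨d, e, he, htop⟩ := exists_isSuccessiveMinima (T := T)
    (D := fun x => ‖φ₁ x‖ * ‖φ₂ x‖) (N := Module.finrank K₁ V₁)
    (fun A hA hAT => hdisc.exists_forall_le hA _ (fun x hx => hval x (hAT x hx)) (inv_pos.2 hM0)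
      fun x hx => hlower x (hAT x hx))
    (fun d e he => by
      obtain ⟨ho, heT⟩ := horth d e he
      simpa using (ho.linearIndependent fun i => h₁ _ (heT i)).fintype_card_le_finrank)
  obtain ⟨ho, heT⟩ := horth d e he
  refine ⟨d, e, ho, ?_, fun i => h₁ _ (heT i), fun i => h₂ _ (heT i), htop⟩
  have he' : IsSuccessiveMinima T (fun x => ‖φ₂ x‖ * ‖φ₁ x‖) e := by
    simpa only [mul_comm] using he
  exact he'.isNormOrthogonal hlead₂ h₂ h₁

/-! ### Norms given by their logarithms -/

/-- `ρ` is the logarithm of an ultrametric norm on the `K`-vector space `V`. -/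
structure IsLogNorm (K : Type*) [NormedField K] {V : Type*} [AddCommGroup V] [Module K V]
    (ρ : V → EReal) : Prop where
  ne_top : ∀ x, ρ x ≠ ⊤
  eq_bot_iff : ∀ x, ρ x = ⊥ ↔ x = 0
  exp_smul : ∀ (c : K) (x : V), (EReal.exp (ρ (c • x))).toReal = ‖c‖ * (EReal.exp (ρ x)).toReal
  add_le : ∀ x y, ρ (x + y) ≤ max (ρ x) (ρ y)

namespace IsLogNorm

variable {K : Type*} [NormedField K] {V : Type*} [AddCommGroup V] [Module K V] {ρ : V → EReal}

theorem exp_le_exp_iff (h : IsLogNorm K ρ) (x y : V) :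
    (EReal.exp (ρ x)).toReal ≤ (EReal.exp (ρ y)).toReal ↔ ρ x ≤ ρ y := by
  rw [ENNReal.toReal_le_toReal (EReal.exp_eq_top_iff.not.2 (h.ne_top x))
    (EReal.exp_eq_top_iff.not.2 (h.ne_top y)), EReal.exp_le_exp_iff]

theorem exp_add_le_max (h : IsLogNorm K ρ) (x y : V) : (EReal.exp (ρ (x + y))).toReal ≤
    max (EReal.exp (ρ x)).toReal (EReal.exp (ρ y)).toReal := by
  rcases le_max_iff.1 (h.add_le x y) with h' | h'
  · exact le_max_of_le_left ((h.exp_le_exp_iff _ _).2 h')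
  · exact le_max_of_le_right ((h.exp_le_exp_iff _ _).2 h')

/-- The norm with logarithm `ρ`. -/
noncomputable def addGroupNorm (h : IsLogNorm K ρ) : AddGroupNorm V where
  toFun x := (EReal.exp (ρ x)).toReal
  map_zero' := by rw [(h.eq_bot_iff 0).2 rfl, EReal.exp_bot, ENNReal.toReal_zero]
  add_le' x y := (h.exp_add_le_max x y).trans
    (max_le_add_of_nonneg ENNReal.toReal_nonneg ENNReal.toReal_nonneg)
  neg' x := by rw [← neg_one_smul K x, h.exp_smul, norm_neg, norm_one, one_mul]
  eq_zero_of_map_eq_zero' x hx := by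
    -- `toReal` also sends ∞ to 0, so the value ⊤ of ρ has to be excluded separately.
    rcases (ENNReal.toReal_eq_zero_iff _).1 hx with h' | h'
    · exact (h.eq_bot_iff x).1 (EReal.exp_eq_zero_iff.1 h')
    · exact absurd (EReal.exp_eq_top_iff.1 h') (h.ne_top x)

/-- A vector space with the norm with logarithm `ρ`. -/
noncomputable abbrev normedAddCommGroup (h : IsLogNorm K ρ) : NormedAddCommGroup V :=
  h.addGroupNorm.toNormedAddCommGroup

/-- A vector space with the norm with logarithm `ρ`. -/
noncomputable abbrev normedSpace (h : IsLogNorm K ρ) :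
    @NormedSpace K V _ h.normedAddCommGroup.toSeminormedAddCommGroup :=
  letI := h.normedAddCommGroup
  { ‹Module K V› with
    norm_smul_le := fun c x => by
      change (EReal.exp (ρ (c • x))).toReal ≤ _
      rw [h.exp_smul]
      exact le_rfl }

theorem isUltrametricDist (h : IsLogNorm K ρ) :
    letI := h.normedAddCommGroup
    IsUltrametricDist V :=
  let _ := h.normedAddCommGroup
  IsUltrametricDist.isUltrametricDist_of_isNonarchimedean_norm h.exp_add_le_max

/-- The ultrametric inequality gives one direction, with ρ 0 = ⊥ for the empty sum; orthogonality is
exactly the other. -/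
theorem sum_eq_sup (h : IsLogNorm K ρ) {n : ℕ} {b : Fin n → V}
    (hb : letI := h.normedAddCommGroup; letI := h.normedSpace; IsNormOrthogonal K b)
    (c : Fin n → K) : ρ (∑ i, c i • b i) = Finset.univ.sup fun i => ρ (c i • b i) := by
  classical
  refine le_antisymm ?_ (Finset.sup_le fun i _ => ?_)
  · induction (Finset.univ : Finset (Fin n)) using Finset.induction_on with
    | empty => simpa using (h.eq_bot_iff 0).2 rfl
    | insert i s his ih =>
      rw [Finset.sum_insert his, Finset.sup_insert]
      exact (h.add_le _ _).trans (max_le_max le_rfl ih)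
  · rw [← h.exp_le_exp_iff, h.exp_smul]
    exact hb c i

end IsLogNorm

/-! ### The two Novikov fields over the group algebra -/

section

variable {κ : Type*} [Field κ] {Γ : AddSubgroup ℝ}

theorem nuUp_zero : nuUp (0 : NovikovUp κ Γ) = ⊤ :=
  iInf₂_eq_top.2 fun _ hg => absurd rfl hg

theorem nuDown_zero : nuDown (0 : NovikovDown κ Γ) = ⊥ :=
  iSup₂_eq_bot.2 fun _ hg => absurd rfl hg

theorem nuUp_of_ne_zero {c : NovikovUp κ Γ} (hc : c ≠ 0) :
    nuUp c = ((c.1.order : ℝ) : EReal) := by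
  have hc' : c.1 ≠ 0 := fun h => hc (Subtype.ext h)
  exact le_antisymm (iInf₂_le c.1.order (HahnSeries.coeff_order_eq_zero.not.2 hc'))
    (le_iInf₂ fun g hg => EReal.coe_le_coe_iff.2
      (Subtype.coe_le_coe.2 (HahnSeries.order_le_of_coeff_ne_zero hg)))

theorem nuDown_of_ne_zero {c : NovikovDown κ Γ} (hc : c ≠ 0) :
    nuDown c = (((OrderDual.ofDual c.1.order : Γ) : ℝ) : EReal) := by
  have hc' : c.1 ≠ 0 := fun h => hc (Subtype.ext h)
  exact le_antisymm (iSup₂_le fun g hg => EReal.coe_le_coe_iff.2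
      (Subtype.coe_le_coe.2 (OrderDual.ofDual_le_ofDual.2
        (HahnSeries.order_le_of_coeff_ne_zero (g := OrderDual.toDual g) hg))))
    (le_iSup₂ (f := fun (g : Γ) (_ : g ∈ {g : Γ | c.coeff g ≠ 0}) => ((g : ℝ) : EReal))
      (OrderDual.ofDual c.1.order) (HahnSeries.coeff_order_eq_zero.not.2 hc'))

theorem nuDown_ne_top (c : NovikovDown κ Γ) : nuDown c ≠ ⊤ := by
  by_cases hc : c = 0
  · rw [hc, nuDown_zero]
    exact bot_ne_top
  · rw [nuDown_of_ne_zero hc]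
    exact EReal.coe_ne_top _

theorem NovikovUp.norm_eq_exp_nuUp (c : NovikovUp κ Γ) : ‖c‖ = (EReal.exp (-nuUp c)).toReal := by
  by_cases hc : c = 0
  · rw [hc, nuUp_zero, norm_zero, EReal.neg_top, EReal.exp_bot, ENNReal.toReal_zero]
  · rw [nuUp_of_ne_zero hc, ← EReal.coe_neg, EReal.exp_coe,
      ENNReal.toReal_ofReal (Real.exp_pos _).le, NovikovUp.norm_def,
      hahnAbs_of_ne_zero _ _ fun h => hc (Subtype.ext h)]
    rfl

theorem NovikovDown.norm_eq_exp_nuDown (c : NovikovDown κ Γ) :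
    ‖c‖ = (EReal.exp (nuDown c)).toReal := by
  by_cases hc : c = 0
  · rw [hc, nuDown_zero, norm_zero, EReal.exp_bot, ENNReal.toReal_zero]
  · rw [nuDown_of_ne_zero hc, EReal.exp_coe, ENNReal.toReal_ofReal (Real.exp_pos _).le,
      NovikovDown.norm_def, hahnAbs_of_ne_zero _ _ fun h => hc (Subtype.ext h)]
    exact congrArg Real.exp (neg_neg _)

theorem NovikovUp.norm_mem {c : NovikovUp κ Γ} (hc : c ≠ 0) : ∃ g : Γ, ‖c‖ = Real.exp g := by
  refine ⟨-c.1.order, ?_⟩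
  rw [NovikovUp.norm_def, hahnAbs_of_ne_zero _ _ fun h => hc (Subtype.ext h)]
  rfl

theorem NovikovDown.norm_mem {c : NovikovDown κ Γ} (hc : c ≠ 0) : ∃ g : Γ, ‖c‖ = Real.exp g := by
  refine ⟨OrderDual.ofDual c.1.order, ?_⟩
  rw [NovikovDown.norm_def, hahnAbs_of_ne_zero _ _ fun h => hc (Subtype.ext h)]
  exact congrArg Real.exp (neg_neg _)

/-- A monomial with nonzero coefficient as a unit of the group algebra. -/
noncomputable def monomialUnit (g : Γ) {a : κ} (ha : a ≠ 0) : (AddMonoidAlgebra κ Γ)ˣ where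
  val := AddMonoidAlgebra.single g a
  inv := AddMonoidAlgebra.single (-g) a⁻¹
  val_inv := by
    rw [AddMonoidAlgebra.single_mul_single, add_neg_cancel, mul_inv_cancel₀ ha,
      AddMonoidAlgebra.one_def]
  inv_val := by
    rw [AddMonoidAlgebra.single_mul_single, neg_add_cancel, inv_mul_cancel₀ ha,
      AddMonoidAlgebra.one_def]

theorem algebraMap_novikovUp_monomialUnit (g : Γ) {a : κ} (ha : a ≠ 0) :
    (algebraMap (AddMonoidAlgebra κ Γ) (NovikovUp κ Γ) (monomialUnit g ha)).1 =
      HahnSeries.single g a :=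
  groupAlgebraToHahnAdd_single κ (AddEquiv.refl Γ) g a

theorem algebraMap_novikovDown_monomialUnit (g : Γ) {a : κ} (ha : a ≠ 0) :
    (algebraMap (AddMonoidAlgebra κ Γ) (NovikovDown κ Γ) (monomialUnit g ha)).1 =
      HahnSeries.single (OrderDual.toDual g) a :=
  groupAlgebraToHahnAdd_single κ (toDualAddEquiv Γ) g a

theorem NovikovUp.norm_monomialUnit (g : Γ) {a : κ} (ha : a ≠ 0) :
    ‖algebraMap (AddMonoidAlgebra κ Γ) (NovikovUp κ Γ) (monomialUnit g ha)‖ =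
      Real.exp (-(g : ℝ)) := by
  rw [NovikovUp.norm_def, algebraMap_novikovUp_monomialUnit,
    hahnAbs_of_ne_zero _ _ (HahnSeries.single_ne_zero ha), HahnSeries.order_single ha]
  rfl

theorem NovikovDown.norm_monomialUnit (g : Γ) {a : κ} (ha : a ≠ 0) :
    ‖algebraMap (AddMonoidAlgebra κ Γ) (NovikovDown κ Γ) (monomialUnit g ha)‖ =
      Real.exp (g : ℝ) := by
  rw [NovikovDown.norm_def, algebraMap_novikovDown_monomialUnit,
    hahnAbs_of_ne_zero _ _ (HahnSeries.single_ne_zero ha), HahnSeries.order_single ha]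
  exact congrArg Real.exp (neg_neg _)

theorem NovikovUp.exists_leading_monomial {c : NovikovUp κ Γ} (hc : c ≠ 0) :
    ∃ m : (AddMonoidAlgebra κ Γ)ˣ, ‖c - algebraMap _ (NovikovUp κ Γ) m.1‖ < ‖c‖ ∧
      ‖algebraMap _ (NovikovUp κ Γ) m.1‖ = ‖c‖ ∧
      ‖algebraMap _ (NovikovUp κ Γ) m.1‖ * ‖algebraMap _ (NovikovDown κ Γ) m.1‖ = 1 := by
  have hc' : c.1 ≠ 0 := fun h => hc (Subtype.ext h)
  refine ⟨monomialUnit c.1.order (HahnSeries.leadingCoeff_ne_zero.2 hc'), ?_, ?_, ?_⟩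
  · have h := hahnAbs_sub_leading_lt Γ.subtype Γ.subtype_strictMono hc'
    rwa [← algebraMap_novikovUp_monomialUnit _ (HahnSeries.leadingCoeff_ne_zero.2 hc')] at h
  · rw [NovikovUp.norm_monomialUnit, NovikovUp.norm_def, hahnAbs_of_ne_zero _ _ hc']
    rfl
  · rw [NovikovUp.norm_monomialUnit, NovikovDown.norm_monomialUnit, ← Real.exp_add,
      neg_add_cancel, Real.exp_zero]

theorem NovikovDown.exists_leading_monomial {c : NovikovDown κ Γ} (hc : c ≠ 0) :
    ∃ m : (AddMonoidAlgebra κ Γ)ˣ, ‖c - algebraMap _ (NovikovDown κ Γ) m.1‖ < ‖c‖ ∧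
      ‖algebraMap _ (NovikovDown κ Γ) m.1‖ = ‖c‖ ∧
      ‖algebraMap _ (NovikovDown κ Γ) m.1‖ * ‖algebraMap _ (NovikovUp κ Γ) m.1‖ = 1 := by
  have hc' : c.1 ≠ 0 := fun h => hc (Subtype.ext h)
  refine ⟨monomialUnit (OrderDual.ofDual c.1.order) (HahnSeries.leadingCoeff_ne_zero.2 hc'),
    ?_, ?_, ?_⟩
  · have h := hahnAbs_sub_leading_lt (dualVal Γ) (dualVal_strictMono Γ) hc'
    rwa [← OrderDual.toDual_ofDual c.1.order,
      ← algebraMap_novikovDown_monomialUnit _ (HahnSeries.leadingCoeff_ne_zero.2 hc')] at h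
  · rw [NovikovDown.norm_monomialUnit, NovikovDown.norm_def, hahnAbs_of_ne_zero _ _ hc']
    exact congrArg Real.exp (neg_neg _).symm
  · rw [NovikovUp.norm_monomialUnit, NovikovDown.norm_monomialUnit, ← Real.exp_add,
      add_neg_cancel, Real.exp_zero]

/-- Any exponent g in the support of `a` bounds the two norms below by exp(-g) and exp(g). -/
theorem one_le_norm_mul_norm {a : AddMonoidAlgebra κ Γ} (ha : a ≠ 0) :
    1 ≤ ‖algebraMap _ (NovikovUp κ Γ) a‖ * ‖algebraMap _ (NovikovDown κ Γ) a‖ := by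
  obtain ⟨g, hg⟩ : ∃ g, a.coeff g ≠ 0 := by
    by_contra! h
    exact ha (by ext g; exact h g)
  have h1 := exp_le_hahnAbs Γ.subtype Γ.subtype_strictMono
    (x := (algebraMap _ (NovikovUp κ Γ) a).1) (g := g) hg
  have h2 := exp_le_hahnAbs (dualVal Γ) (dualVal_strictMono Γ)
    (x := (algebraMap _ (NovikovDown κ Γ) a).1) (g := OrderDual.toDual g) hg
  calc (1 : ℝ) = Real.exp (-(g : ℝ)) * Real.exp (- -(g : ℝ)) := by
        rw [← Real.exp_add, add_neg_cancel, Real.exp_zero]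
    _ ≤ _ := mul_le_mul h1 h2 (Real.exp_pos _).le (AbsoluteValue.nonneg _ _)

theorem algebraMap_novikovUp_ne_zero {a : AddMonoidAlgebra κ Γ} (ha : a ≠ 0) :
    algebraMap _ (NovikovUp κ Γ) a ≠ 0 := by
  intro h
  have := one_le_norm_mul_norm ha
  rw [h, norm_zero, zero_mul] at this
  linarith

theorem algebraMap_novikovDown_ne_zero {a : AddMonoidAlgebra κ Γ} (ha : a ≠ 0) :
    algebraMap _ (NovikovDown κ Γ) a ≠ 0 := by
  intro h
  have := one_le_norm_mul_norm ha
  rw [h, norm_zero, mul_zero] at this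
  linarith

/-- This is where discreteness of Γ enters: a discrete subgroup is closed, so it meets compact
intervals in finite sets. -/
theorem isDiscretePos_exp (hΓ : DiscreteTopology Γ) :
    IsDiscretePos {r | ∃ g : Γ, r = Real.exp g} := by
  intro a b ha
  have hfin : (Set.Icc (Real.log a) (Real.log b) ∩ (Γ : Set ℝ)).Finite :=
    Metric.finite_isBounded_inter_isClosed (SetLike.isDiscrete_iff_discreteTopology.2 hΓ)
      (Metric.isBounded_Icc _ _) AddSubgroup.isClosed_of_discrete
  refine (hfin.image Real.exp).subset ?_
  rintro _ ⟨⟨g, rfl⟩, h1, h2⟩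
  exact ⟨g, ⟨⟨(Real.log_le_iff_le_exp ha).2 h1,
    (Real.le_log_iff_exp_le ((Real.exp_pos _).trans_le h2)).2 h2⟩, g.2⟩, rfl⟩

theorem IsNormUp.isLogNorm {V : Type*} [AddCommGroup V] [Module (NovikovUp κ Γ) V] {ρ : V → EReal}
    (h : IsNormUp (κ := κ) (Γ := Γ) ρ) : IsLogNorm (NovikovUp κ Γ) ρ where
  ne_top := h.ne_top
  eq_bot_iff := h.eq_bot_iff
  exp_smul c x := by
    rw [h.smul, sub_eq_add_neg, EReal.exp_add, ENNReal.toReal_mul, mul_comm,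
      NovikovUp.norm_eq_exp_nuUp]
  add_le := h.add_le

theorem IsNormDown.isLogNorm {V : Type*} [AddCommGroup V] [Module (NovikovDown κ Γ) V]
    {ρ : V → EReal} (h : IsNormDown (κ := κ) (Γ := Γ) ρ) :
    IsLogNorm (NovikovDown κ Γ) fun x => -ρ x where
  ne_top x := EReal.neg_eq_top_iff.not.2 (h.ne_bot x)
  eq_bot_iff x := EReal.neg_eq_bot_iff.trans (h.eq_top_iff x)
  exp_smul c x := by
    -- In `EReal`, negating a difference fails when both terms are the same infinity; ρ ≠ ⊥ and ν^↓
    -- ≠ ⊤ exclude this.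
    rw [h.smul, EReal.neg_sub (.inl (h.ne_bot x)) (.inr (nuDown_ne_top c)), EReal.exp_add,
      ENNReal.toReal_mul, mul_comm, NovikovDown.norm_eq_exp_nuDown]
  add_le x y := by
    rcases min_le_iff.1 (h.le_add x y) with h' | h'
    · exact le_max_of_le_left (EReal.neg_le_neg_iff.2 h')
    · exact le_max_of_le_right (EReal.neg_le_neg_iff.2 h')

end

/-! ### The main theorem -/

theorem LinearMap.eq_zero_of_mem_torsion {R K H V : Type*} [CommRing R] [IsDomain R] [Field K]
    [Algebra R K] [AddCommGroup H] [Module R H] [AddCommGroup V] [Module K V] [Module R V]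
    [IsScalarTower R K V] (hinj : ∀ a : R, a ≠ 0 → algebraMap R K a ≠ 0) (φ : H →ₗ[R] V) {x : H}
    (hx : x ∈ Submodule.torsion R H) : φ x = 0 := by
  obtain ⟨a, ha⟩ := (Submodule.mem_torsion_iff x).1 hx
  have h : algebraMap R K a • φ x = 0 := by
    rw [algebraMap_smul, ← map_smul]
    exact (congrArg φ ha).trans (map_zero φ)
  exact (smul_eq_zero.1 h).resolve_left (hinj _ (nonZeroDivisors.ne_zero a.2))

/-- φ kills T, so its image lies in the span of the φ (e i); a base change is generated over K by
that image. -/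
theorem IsBaseChange.span_eq_top_of_sup_eq_top {R K H V : Type*} [CommRing R] [Field K]
    [Algebra R K] [AddCommGroup H] [Module R H] [AddCommGroup V] [Module K V] [Module R V]
    [IsScalarTower R K V] {φ : H →ₗ[R] V} (hφ : IsBaseChange K φ) {T : Submodule R H}
    (hT : ∀ x ∈ T, φ x = 0) {ι : Type*} {e : ι → H}
    (he : T ⊔ Submodule.span R (Set.range e) = ⊤) :
    Submodule.span K (Set.range fun i => φ (e i)) = ⊤ := by
  have hmem : ∀ x, φ x ∈ Submodule.span K (Set.range fun i => φ (e i)) := by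
    intro x
    have hle : T ⊔ Submodule.span R (Set.range e) ≤
        ((Submodule.span K (Set.range fun i => φ (e i))).restrictScalars R).comap φ := by
      refine sup_le (fun y hy => ?_) (Submodule.span_le.2 ?_)
      · change φ y ∈ Submodule.span K _
        rw [hT y hy]
        exact zero_mem _
      · rintro _ ⟨i, rfl⟩
        exact Submodule.subset_span ⟨i, rfl⟩
    exact hle (he ▸ Submodule.mem_top)
  refine eq_top_iff.2 fun v _ => ?_
  exact hφ.inductionOn v _ (zero_mem _) hmem (fun s _ h => Submodule.smul_mem _ s h)
    fun _ _ h h' => add_mem h h'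

/-- A relation modulo T becomes, after applying φ, a relation over K with the same coefficients. -/
theorem LinearIndependent.mkQ_of_map {R K H V : Type*} [CommRing R] [Field K]
    [Algebra R K] [AddCommGroup H] [Module R H] [AddCommGroup V] [Module K V] [Module R V]
    [IsScalarTower R K V] (hinj : ∀ a : R, a ≠ 0 → algebraMap R K a ≠ 0) {φ : H →ₗ[R] V}
    {T : Submodule R H} (hT : ∀ x ∈ T, φ x = 0) {ι : Type*} [Fintype ι] {e : ι → H}
    (he : LinearIndependent K fun i => φ (e i)) : LinearIndependent R fun i => T.mkQ (e i) := by
  rw [Fintype.linearIndependent_iff] at he ⊢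
  intro c hc i
  have hmem : ∑ j, c j • e j ∈ T := by
    rw [← Submodule.Quotient.mk_eq_zero T, ← Submodule.mkQ_apply, map_sum]
    simpa only [map_smul] using hc
  have h := hT _ hmem
  rw [map_sum] at h
  by_contra hci
  refine hinj _ hci (he (fun j => algebraMap R K (c j)) ?_ i)
  simpa only [algebraMap_smul, map_smul] using h

theorem mainTheorem2 {κ : Type*} [Field κ] (Γ : AddSubgroup ℝ) (hΓ : DiscreteTopology Γ)
    {H : Type*} [AddCommGroup H] [Module (AddMonoidAlgebra κ Γ) H]
    {Vup : Type*} [AddCommGroup Vup] [Module (NovikovUp κ Γ) Vup]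
    [Module (AddMonoidAlgebra κ Γ) Vup] [IsScalarTower (AddMonoidAlgebra κ Γ) (NovikovUp κ Γ) Vup]
    {Vdown : Type*} [AddCommGroup Vdown] [Module (NovikovDown κ Γ) Vdown]
    [Module (AddMonoidAlgebra κ Γ) Vdown]
    [IsScalarTower (AddMonoidAlgebra κ Γ) (NovikovDown κ Γ) Vdown]
    (P : FilteredMatchedPair κ Γ H Vup Vdown) :
    ∃ (d : ℕ) (e : Fin d → H), P.IsDoublyOrthogonalBasis e := by
  have hup := P.isNorm_up.isLogNorm
  have hdown := P.isNorm_down.isLogNorm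
  have := P.finite_H
  obtain ⟨n, l, hl⟩ := exists_functionals_detecting_torsion (AddMonoidAlgebra κ Γ) H
  obtain ⟨d, e, ho₁, ho₂, h0₁, h0₂, htop⟩ :
      ∃ (d : ℕ) (e : Fin d → H),
        (letI := hup.normedAddCommGroup; letI := hup.normedSpace
          IsNormOrthogonal (NovikovUp κ Γ) fun i => P.phiUp (e i)) ∧
        (letI := hdown.normedAddCommGroup; letI := hdown.normedSpace
          IsNormOrthogonal (NovikovDown κ Γ) fun i => P.phiDown (e i)) ∧
        (∀ i, P.phiUp (e i) ≠ 0) ∧ (∀ i, P.phiDown (e i) ≠ 0) ∧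
        Submodule.torsion (AddMonoidAlgebra κ Γ) H ⊔ Submodule.span _ (Set.range e) = ⊤ := by
    let _ := hup.normedAddCommGroup
    let _ := hup.normedSpace
    let _ := hdown.normedAddCommGroup
    let _ := hdown.normedSpace
    have := hup.isUltrametricDist
    have := hdown.isUltrametricDist
    have := P.finite_up
    have := P.finite_down
    refine exists_isNormOrthogonal_both P.phiUp P.phiDown (isDiscretePos_exp hΓ) ?_
      (fun c hc => NovikovUp.norm_mem hc) (fun c hc => NovikovDown.norm_mem hc)
      (fun c hc => NovikovUp.exists_leading_monomial hc)
      (fun c hc => NovikovDown.exists_leading_monomial hc) (fun a ha => one_le_norm_mul_norm ha)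
      l hl
      -- The universal property of base change extends each functional on H to one on the vector
      -- space.
      (fun j => P.isBaseChange_up.lift (Algebra.linearMap _ _ ∘ₗ l j))
      (fun j x => P.isBaseChange_up.lift_eq _ x)
      (fun j => P.isBaseChange_down.lift (Algebra.linearMap _ _ ∘ₗ l j))
      (fun j x => P.isBaseChange_down.lift_eq _ x)
    rintro _ ⟨g, rfl⟩ _ ⟨g', rfl⟩
    exact ⟨g + g', by rw [AddSubgroup.coe_add, Real.exp_add]⟩
  have hinj₁ : ∀ a : AddMonoidAlgebra κ Γ, a ≠ 0 → algebraMap _ (NovikovUp κ Γ) a ≠ 0 :=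
    fun a ha => algebraMap_novikovUp_ne_zero ha
  have hinj₂ : ∀ a : AddMonoidAlgebra κ Γ, a ≠ 0 → algebraMap _ (NovikovDown κ Γ) a ≠ 0 :=
    fun a ha => algebraMap_novikovDown_ne_zero ha
  have hT₁ : ∀ x ∈ Submodule.torsion (AddMonoidAlgebra κ Γ) H, P.phiUp x = 0 :=
    fun x hx => P.phiUp.eq_zero_of_mem_torsion hinj₁ hx
  have hT₂ : ∀ x ∈ Submodule.torsion (AddMonoidAlgebra κ Γ) H, P.phiDown x = 0 :=
    fun x hx => P.phiDown.eq_zero_of_mem_torsion hinj₂ hx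
  have hli₁ : LinearIndependent (NovikovUp κ Γ) fun i => P.phiUp (e i) :=
    let _ := hup.normedAddCommGroup
    let _ := hup.normedSpace
    ho₁.linearIndependent h0₁
  have hli₂ : LinearIndependent (NovikovDown κ Γ) fun i => P.phiDown (e i) :=
    let _ := hdown.normedAddCommGroup
    let _ := hdown.normedSpace
    ho₂.linearIndependent h0₂
  refine ⟨d, e, hli₁.mkQ_of_map hinj₁ hT₁, ?_,
    ⟨hli₁, P.isBaseChange_up.span_eq_top_of_sup_eq_top hT₁ htop, fun c => ?_⟩,
    ⟨hli₂, P.isBaseChange_down.span_eq_top_of_sup_eq_top hT₂ htop, fun c => ?_⟩⟩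
  · have h := congrArg (Submodule.map (Submodule.torsion (AddMonoidAlgebra κ Γ) H).mkQ) htop
    rw [Submodule.map_sup, Submodule.map_span, Submodule.map_top, Submodule.range_mkQ,
      Submodule.mkQ_map_self, bot_sup_eq, ← Set.range_comp] at h
    exact h
  · rw [hup.sum_eq_sup ho₁ c]
    exact Finset.sup_congr rfl fun i _ => P.isNorm_up.smul _ _
  · have h := hdown.sum_eq_sup ho₂ c
    have hinf : Finset.univ.inf (fun i => P.rhoDown (P.phiDown (e i)) - nuDown (c i)) =
        Finset.univ.inf fun i => P.rhoDown (c i • P.phiDown (e i)) :=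
      Finset.inf_congr rfl fun i _ => (P.isNorm_down.smul _ _).symm
    rw [hinf]
    refine le_antisymm (Finset.le_inf fun i hi => ?_) ?_
    · rw [← EReal.neg_le_neg_iff, h]
      exact Finset.le_sup (f := fun i => -P.rhoDown (c i • P.phiDown (e i))) hi
    · rw [← EReal.neg_le_neg_iff, h]
      exact Finset.sup_le fun i hi => EReal.neg_le_neg_iff.2 (Finset.inf_le hi)
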